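/- **Theorem (Monotonicity).** Let $\sigma$ be the signature with $0,1,+,\cdot,\le$ and a unary predicate $\mathit{Int}$ (with equality). Let $\mathbf{LIRR}$ be the $\sigma$-theory axiomatized by: the commutative ring axioms; $\le$ is a partial order with $x\le y\Rightarrow x+z\le y+z$; $0\le 1$ and $0\ne 1$; for each $n\ge 1$, $\exists x.\ nx=1$; for each $n\ge 1$, $\forall x.\ 0\le nx\Rightarrow 0\le x$; $\mathit{Int}(1)$, and $\mathit{Int}$ is closed under addition and additive inverses; and for all integers $n\ge 1$ and $m$, $\forall x.\ \mathit{Int}(x)\wedge 0\le nx+m\Rightarrow 0\le x+\lfloor m/n\rfloor$. Write $F\models_{\mathbf{LIRR}}G$ if every model of $\mathbf{LIRR}$ under every valuation that satisfies $F$ satisfies $G$. Atoms $0\le p$, $0=p$ with $p$ a rational polynomial are used, being translated into $\sigma$ by clearing denominators and moving negative terms to the other side. Let $X$ be a finite set of variables and $X'=\{x':x\in X\}$ a disjoint set of primed copies. A *transition formula* is a first-order $\sigma$-formula with free variables in $X\cup X'$ that is equivalent modulo $\mathbf{LIRR}$ to an existential formula (a quantifier-free formula preceded by a possibly empty block of existential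 quantifiers). For finite sets $Z,P$ of rational polynomials let $\mathit{alg.cone}(Z,P)=\langle Z\rangle+\mathbb{Q}^{\ge0}P$ be the sum of the ideal generated by $Z$ and the convex cone generated by $P$. For a formula $F$ over $X\cup X'$, let $\mathbf{C}(F)=\{p\in\mathbb{Q}[X\cup X'] : F\models_{\mathbf{LIRR}}0\le p\}$ and let $\mathit{LinInv}(F)$ be the space of homogeneous linear polynomials $k$ over $X$ with $F\models_{\mathbf{LIRR}}k'=k$. The formula $\mathit{exp}(F,t)$ is obtained as follows. Choose a basis $a_1,\dots,a_n$ of $\mathit{LinInv}(F)$ and fresh variables $D=\{d_x:x\in X\}$, $K=\{k_1,\dots,k_n\}$. Let $\delta_{\mathit{inv}}:\mathbb{Q}[D,K]\to\mathbb{Q}[X\cup X']$ be the ring homomorphism with $d_x\mapsto x-x'$ and $k_i\mapsto a_i$; let $\delta$ and $\mathit{inv}$ be its restrictions to $\mathbb{Q}[D]$ and $\mathbb{Q}[K]$. Choose finite sets $Z,P$ with $\mathit{alg.cone}(Z,P)=\mathbf{C}(F)$, then finite $Z',P'\subseteq\mathbb{Q}[D,K]$ with $\mathit{alg.cone}(Z',P')=\delta_{\mathit{inv}}^{-1}(\mathit{alg.cone}(Z,P))$,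 then finite $V\subseteq\mathbb{Q}[K]$ and $R\subseteq\mathbb{Q}[D,K]$ with $$\mathbb{Q}[K]\,V+\mathbb{Q}^{\ge0}R=\mathit{alg.cone}(Z',P')\cap(\mathbb{Q}D+\mathbb{Q}[K]),$$ where $\mathbb{Q}D$ is the rational span of $D$. With $\pi_D,\pi_K$ the projections of $\mathbb{Q}D+\mathbb{Q}[K]$ onto its summands and $\mathit{cf}(p)=\delta(\pi_D(p))+t\cdot\mathit{inv}(\pi_K(p))$, set $$\mathit{exp}(F,t)=\bigwedge_{v\in V}0=\mathit{cf}(v)\ \wedge\ \bigwedge_{r\in R}0\le\mathit{cf}(r),\qquad F^\star=\exists t.\ \mathit{Int}(t)\wedge 0\le t\wedge\mathit{exp}(F,t).$$ Then $F^\star$ exists for every transition formula $F$ (that is, finite sets as required can always be chosen), and the operator is monotone: if $F\models_{\mathbf{LIRR}}G$, then $F^\star\models_{\mathbf{LIRR}}G^\star$, whichever choices are made in forming $F^\star$ and $G^\star$. (Monotonicity holds for all first-order formulas $F,G$ over $X\cup X'$ for which $F^\star$ and $G^\star$ can be formed.) -/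

import Mathlib

open scoped FirstOrder Pointwise

namespace LIRing

/-! ### The signature of ordered rings with an integrality predicate -/

/-- Function symbols: the constants `0`, `1` and the binary operations `+`, `·`. -/
inductive Func : ℕ → Type
  | zero : Func 0
  | one : Func 0
  | add : Func 2
  | mul : Func 2

/-- Relation symbols (besides equality): the binary `≤` and the unary `Int`. -/
inductive Rel : ℕ → Type
  | le : Rel 2
  | int : Rel 1

/-- The signature of ordered rings extended with the unary predicate `Int`. -/
abbrev sig : FirstOrder.Language.{0, 0} := ⟨Func, Rel⟩

/-- The constant term `0`. -/
def tZero {α : Type*} : sig.Term α := FirstOrder.Language.Constants.term (L := sig) Func.zero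

/-- The constant term `1`. -/
def tOne {α : Type*} : sig.Term α := FirstOrder.Language.Constants.term (L := sig) Func.one

/-- The term `s + t`. -/
def tAdd {α : Type*} (s t : sig.Term α) : sig.Term α :=
  FirstOrder.Language.Functions.apply₂ (L := sig) Func.add s t

/-- The term `s · t`. -/
def tMul {α : Type*} (s t : sig.Term α) : sig.Term α :=
  FirstOrder.Language.Functions.apply₂ (L := sig) Func.mul s t

/-- The `n`-fold sum `t + ⋯ + t`. -/
def tNsmul {α : Type*} : ℕ → sig.Term α → sig.Term α
  | 0, _ => tZero
  | n + 1, t => tAdd (tNsmul n t) t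

/-- The `n`-fold product `t · ⋯ · t`. -/
def tPow {α : Type*} : ℕ → sig.Term α → sig.Term α
  | 0, _ => tOne
  | n + 1, t => tMul (tPow n t) t

/-- The numeral `1 + ⋯ + 1`. -/
def tNat {α : Type*} (n : ℕ) : sig.Term α := tNsmul n tOne

/-- The atom `s ≤ t`. -/
def fLe {α : Type*} {n : ℕ} (s t : sig.Term (α ⊕ Fin n)) : sig.BoundedFormula α n :=
  FirstOrder.Language.Relations.boundedFormula₂ (L := sig) Rel.le s t

/-- The atom `Int(t)`. -/
def fInt {α : Type*} {n : ℕ} (t : sig.Term (α ⊕ Fin n)) : sig.BoundedFormula α n :=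
  FirstOrder.Language.Relations.boundedFormula₁ (L := sig) Rel.int t

/-! ### The theory of linear integer/real rings -/

/-- The axioms of commutative rings (in the signature without subtraction). -/
def ringAxioms : sig.Theory :=
  { ∀' ∀' ∀' (tAdd (&0) (tAdd (&1) (&2)) =' tAdd (tAdd (&0) (&1)) (&2)),
    ∀' ∀' ∀' (tMul (&0) (tMul (&1) (&2)) =' tMul (tMul (&0) (&1)) (&2)),
    ∀' ∀' (tAdd (&0) (&1) =' tAdd (&1) (&0)),
    ∀' ∀' (tMul (&0) (&1) =' tMul (&1) (&0)),
    ∀' (tAdd (&0) tZero =' (&0)),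
    ∀' (tMul (&0) tOne =' (&0)),
    ∀' ∀' ∀' (tMul (&0) (tAdd (&1) (&2)) =' tAdd (tMul (&0) (&1)) (tMul (&0) (&2))),
    ∀' ∃' (tAdd (&0) (&1) =' tZero) }

/-- Reflexivity, transitivity, antisymmetry, compatibility with addition, and non-triviality. -/
def orderAxioms : sig.Theory :=
  { ∀' (fLe (&0) (&0)),
    ∀' ∀' ∀' (fLe (&0) (&1) ⊓ fLe (&1) (&2) ⟹ fLe (&0) (&2)),
    ∀' ∀' (fLe (&0) (&1) ⊓ fLe (&1) (&0) ⟹ (&0) =' (&1)),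
    ∀' ∀' ∀' (fLe (&0) (&1) ⟹ fLe (tAdd (&0) (&2)) (tAdd (&1) (&2))),
    fLe tZero tOne ⊓ ∼(tZero =' tOne) }

/-- Divisibility: `∃ x, x + ⋯ + x = 1` (`n` summands). -/
def divisibility (n : ℕ) : sig.Sentence :=
  ∃' (tNsmul n (&0) =' tOne)

/-- Perforation-freeness: `∀ x, 0 ≤ x + ⋯ + x → 0 ≤ x` (`n` summands). -/
def perforationFree (n : ℕ) : sig.Sentence :=
  ∀' (fLe tZero (tNsmul n (&0)) ⟹ fLe tZero (&0))

/-- The theory of linear real rings. -/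
def LRR : sig.Theory :=
  ringAxioms ∪ orderAxioms ∪
    {φ | ∃ n : ℕ, 1 ≤ n ∧ φ = divisibility n} ∪ {φ | ∃ n : ℕ, 1 ≤ n ∧ φ = perforationFree n}

/-- `Int` contains `1` and is closed under addition and negation. -/
def intAxioms : sig.Theory :=
  { fInt tOne,
    ∀' ∀' (fInt (&0) ⊓ fInt (&1) ⟹ fInt (tAdd (&0) (&1))),
    ∀' ∀' (fInt (&0) ⊓ (tAdd (&0) (&1) =' tZero) ⟹ fInt (&1)) }

/-- The inequality `0 ≤ t + c` for an integer `c`, with a negative `c` moved to the left. -/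
def fNonnegAdd {α : Type*} {n : ℕ} (t : sig.Term (α ⊕ Fin n)) (c : ℤ) : sig.BoundedFormula α n :=
  fLe (tNat (-c).toNat) (tAdd t (tNat c.toNat))

/-- Cutting plane: `∀ x, Int(x) ∧ 0 ≤ n x + m → 0 ≤ x + ⌊m / n⌋`. -/
def cuttingPlane (n : ℕ) (m : ℤ) : sig.Sentence :=
  ∀' (fInt (&0) ⊓ fNonnegAdd (tNsmul n (&0)) m ⟹ fNonnegAdd (&0) ⌊(m : ℚ) / (n : ℚ)⌋)

/-- The theory of linear integer/real rings. -/
def LIRR : sig.Theory :=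
  LRR ∪ intAxioms ∪ {φ | ∃ (n : ℕ) (m : ℤ), 1 ≤ n ∧ φ = cuttingPlane n m}

/-- Entailment modulo linear integer/real rings: in every model and under every valuation,
`F` implies `G`. -/
def Entails {α : Type*} (F G : sig.Formula α) : Prop := F ⟹[LIRR] G

/-! ### Atoms over polynomials with rational coefficients

An atom `0 ≤ p` or `0 = p` with rational coefficients is translated into the signature by
multiplying with a common denominator and moving the monomials with a negative coefficient to
the left-hand side. -/

section Atoms

variable {α : Type*}

/-- A positive common denominator of the coefficients of `p`. -/
def commonDen (p : MvPolynomial α ℚ) : ℕ := ∏ m ∈ p.support, (p.coeff m).den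

/-- The term of a monomial. -/
noncomputable def tMonomial (m : α →₀ ℕ) : sig.Term α :=
  (m.support.toList.map fun i => tPow (m i) (FirstOrder.Language.Term.var i)).foldr tMul tOne

/-- The positive part of `N • p`, where `N` is the common denominator, as a term. -/
noncomputable def tPos (p : MvPolynomial α ℚ) : sig.Term α :=
  (p.support.toList.map fun m =>
    tNsmul ((commonDen p : ℚ) * p.coeff m).num.toNat (tMonomial m)).foldr tAdd tZero

/-- The negative part of `N • p`, where `N` is the common denominator, as a term. -/
noncomputable def tNeg (p : MvPolynomial α ℚ) : sig.Term α :=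
  (p.support.toList.map fun m =>
    tNsmul (-((commonDen p : ℚ) * p.coeff m)).num.toNat (tMonomial m)).foldr tAdd tZero

/-- The formula `0 ≤ p`. -/
noncomputable def fNonneg {n : ℕ} (p : MvPolynomial (α ⊕ Fin n) ℚ) : sig.BoundedFormula α n :=
  fLe (tNeg p) (tPos p)

/-- The formula `0 = p`. -/
noncomputable def fZero {n : ℕ} (p : MvPolynomial (α ⊕ Fin n) ℚ) : sig.BoundedFormula α n :=
  tNeg p =' tPos p

/-- `F ⊨ 0 ≤ p` modulo linear integer/real rings. -/
def EntailsNonneg (F : sig.Formula α) (p : MvPolynomial α ℚ) : Prop :=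
  Entails F (fNonneg (MvPolynomial.rename Sum.inl p))

/-- `F ⊨ 0 = p` modulo linear integer/real rings. -/
def EntailsZero (F : sig.Formula α) (p : MvPolynomial α ℚ) : Prop :=
  Entails F (fZero (MvPolynomial.rename Sum.inl p))

/-- The consequence cone of `F`: all polynomials that `F` entails to be nonnegative. -/
def consequenceCone (F : sig.Formula α) : Set (MvPolynomial α ℚ) := {p | EntailsNonneg F p}

/-- The algebraic cone of a pair `(Z, P)`: the ideal generated by the zeros `Z` plus the convex
cone over `ℚ` generated by the positives `P`. -/
def algCone (Z P : Finset (MvPolynomial α ℚ)) : Set (MvPolynomial α ℚ) :=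
  (Ideal.span (Z : Set (MvPolynomial α ℚ)) : Set (MvPolynomial α ℚ)) +
    (PointedCone.hull ℚ (P : Set (MvPolynomial α ℚ)) : Set (MvPolynomial α ℚ))

/-- The linear terms (without constant term): the rational span of the variables. -/
noncomputable def linTerms (α : Type*) : Submodule ℚ (MvPolynomial α ℚ) :=
  Submodule.span ℚ (Set.range MvPolynomial.X)

end Atoms

/-! ### Transition formulas

The variable `x` of the pre-state is `Sum.inl x`, its primed copy `x'` is `Sum.inr x`. -/

section Star

variable {X : Type*}

/-- A transition formula: a formula over the unprimed and primed variables that is equivalent,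
modulo linear integer/real rings, to an existential formula (a ground formula below a possibly
empty block of existential quantifiers).  This covers ground formulas, their projections, and
sequential compositions. -/
def IsTransitionFormula (F : sig.Formula (X ⊕ X)) : Prop :=
  ∃ E : sig.Formula (X ⊕ X), E.IsExistential ∧ F ⇔[LIRR] E

/-- A polynomial over the pre-state. -/
noncomputable def pre (p : MvPolynomial X ℚ) : MvPolynomial (X ⊕ X) ℚ :=
  MvPolynomial.rename Sum.inl p

/-- The primed copy of a polynomial. -/
noncomputable def post (p : MvPolynomial X ℚ) : MvPolynomial (X ⊕ X) ℚ :=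
  MvPolynomial.rename Sum.inr p

/-- The linear terms `k` with `F ⊨ k' = k`. -/
def linInv (F : sig.Formula (X ⊕ X)) : Set (MvPolynomial X ℚ) :=
  {k | k ∈ linTerms X ∧ EntailsZero F (post k - pre k)}

/-! Polynomials over difference variables `d_x` (`Sum.inl x`) and invariant variables `k_i`
(`Sum.inr i`). -/

/-- The homomorphism with `d_x ↦ x - x'`. -/
noncomputable def delta : MvPolynomial X ℚ →ₐ[ℚ] MvPolynomial (X ⊕ X) ℚ :=
  MvPolynomial.aeval fun x => MvPolynomial.X (Sum.inl x) - MvPolynomial.X (Sum.inr x)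

/-- The homomorphism with `k_i ↦ a_i`. -/
noncomputable def inv {n : ℕ} (a : Fin n → MvPolynomial X ℚ) :
    MvPolynomial (Fin n) ℚ →ₐ[ℚ] MvPolynomial X ℚ :=
  MvPolynomial.aeval a

/-- The common extension with `d_x ↦ x - x'` and `k_i ↦ a_i`. -/
noncomputable def deltaInv {n : ℕ} (a : Fin n → MvPolynomial X ℚ) :
    MvPolynomial (X ⊕ Fin n) ℚ →ₐ[ℚ] MvPolynomial (X ⊕ X) ℚ :=
  MvPolynomial.aeval (Sum.elim
    (fun x => MvPolynomial.X (Sum.inl x) - MvPolynomial.X (Sum.inr x)) (fun i => pre (a i)))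

/-- The space of polynomials that are the sum of a linear term in the variables `d_x` and an
arbitrary polynomial in the variables `k_i`. -/
def linPlusPoly (X : Type*) (n : ℕ) : Set (MvPolynomial (X ⊕ Fin n) ℚ) :=
  {p | ∃ d ∈ linTerms X, ∃ k : MvPolynomial (Fin n) ℚ,
    p = MvPolynomial.rename Sum.inl d + MvPolynomial.rename Sum.inr k}

/-- The set of all `v + r`, where `v` is in the ideal of the polynomial ring in the `k_i`
generated by `V`, and `r` is in the convex cone generated by `R`. -/
def linCone {n : ℕ} (V : Finset (MvPolynomial (Fin n) ℚ))
    (R : Finset (MvPolynomial (X ⊕ Fin n) ℚ)) : Set (MvPolynomial (X ⊕ Fin n) ℚ) :=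
  (MvPolynomial.rename Sum.inr : MvPolynomial (Fin n) ℚ → MvPolynomial (X ⊕ Fin n) ℚ) ''
      (Ideal.span (V : Set (MvPolynomial (Fin n) ℚ)) : Set (MvPolynomial (Fin n) ℚ)) +
    (PointedCone.hull ℚ (R : Set (MvPolynomial (X ⊕ Fin n) ℚ)) :
      Set (MvPolynomial (X ⊕ Fin n) ℚ))

variable [Fintype X]

/-- The part of a polynomial that is linear in the variables `d_x`, as a polynomial in these
variables. -/
noncomputable def projD {n : ℕ} (p : MvPolynomial (X ⊕ Fin n) ℚ) : MvPolynomial X ℚ :=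
  ∑ x : X, MvPolynomial.C (p.coeff (Finsupp.single (Sum.inl x) 1)) * MvPolynomial.X x

/-- The part of a polynomial without the variables `d_x`, as a polynomial in the `k_i`. -/
noncomputable def projK {n : ℕ} (p : MvPolynomial (X ⊕ Fin n) ℚ) : MvPolynomial (Fin n) ℚ :=
  MvPolynomial.aeval (Sum.elim (fun _ => 0) MvPolynomial.X) p

/-- The closed form `δ(π_D(p)) + t · inv(π_K(p))`, where `t` is the bound variable. -/
noncomputable def closedForm {n : ℕ} (a : Fin n → MvPolynomial X ℚ)
    (p : MvPolynomial (X ⊕ Fin n) ℚ) : MvPolynomial ((X ⊕ X) ⊕ Fin 1) ℚ :=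
  MvPolynomial.rename Sum.inl (delta (projD p)) +
    MvPolynomial.X (Sum.inr 0) * MvPolynomial.rename Sum.inl (pre (inv a (projK p)))

/-- The formula `⋀ v ∈ V, 0 = cf(v) ∧ ⋀ r ∈ R, 0 ≤ cf(r)`, with free variable `t`. -/
noncomputable def expFormula {n : ℕ} (a : Fin n → MvPolynomial X ℚ)
    (V : Finset (MvPolynomial (Fin n) ℚ)) (R : Finset (MvPolynomial (X ⊕ Fin n) ℚ)) :
    sig.BoundedFormula (X ⊕ X) 1 :=
  FirstOrder.Language.BoundedFormula.iInf
      (fun v : V => fZero (closedForm a (MvPolynomial.rename Sum.inr v.1))) ⊓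
    FirstOrder.Language.BoundedFormula.iInf
      (fun r : R => fNonneg (closedForm a r.1))

/-- `E` is a possible result of the symbolic approximation `exp(F, t)` of the `t`-fold
composition of `F`: choose a basis `a` of the linear invariants of `F`, let `(Z, P)` represent
the consequence cone of `F`, let `(Z', P')` represent its inverse image under `deltaInv a`, let
`(V, R)` represent the restriction of the latter to polynomials linear in the difference
variables, and take the conjunction of the closed forms.  No particular choice of bases and
generators is imposed. -/
def IsExp (F : sig.Formula (X ⊕ X)) (E : sig.BoundedFormula (X ⊕ X) 1) : Prop :=
  ∃ (n : ℕ) (a : Fin n → MvPolynomial X ℚ)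
    (Z P : Finset (MvPolynomial (X ⊕ X) ℚ)) (Z' P' : Finset (MvPolynomial (X ⊕ Fin n) ℚ))
    (V : Finset (MvPolynomial (Fin n) ℚ)) (R : Finset (MvPolynomial (X ⊕ Fin n) ℚ)),
    LinearIndependent ℚ a ∧
    (Submodule.span ℚ (Set.range a) : Set (MvPolynomial X ℚ)) = linInv F ∧
    algCone Z P = consequenceCone F ∧
    algCone Z' P' = deltaInv a ⁻¹' algCone Z P ∧
    linCone V R = algCone Z' P' ∩ linPlusPoly X n ∧
    E = expFormula a V R

/-- `S` is a possible value of the approximate reflexive transitive closure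
`∃ t, Int(t) ∧ t ≥ 0 ∧ exp(F, t)` of `F`. -/
def IsStar (F S : sig.Formula (X ⊕ X)) : Prop :=
  ∃ E : sig.BoundedFormula (X ⊕ X) 1, IsExp F E ∧
    S = ∃' (fInt (&0) ⊓ (fLe tZero (&0) ⊓ E))

end Star

end LIRing

-- Monotonicity is a change of variables. If `F` entails `G`, every linear invariant of `G` is one
-- of `F`, so the basis chosen for `G` consists of rational combinations of the basis chosen for
-- `F`. Substituting these combinations for the invariant variables of `G` gives a homomorphism `η`
-- with `deltaInv a ∘ η = deltaInv b`. The consequence cone of `G` lies in that of `F`, so `η`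
-- carries the restricted cone of `G` into that of `F`, and it preserves closed forms there. Every
-- member of the restricted cone of `F` has a nonnegative closed form wherever `exp(F, t)` holds
-- (`closedForm_mem_pos`). Hence `exp(F, t)` implies `exp(G, t)` for the same `t`. Generators enter
-- only through the cones they generate, so their choice does not matter (`IsStar.mono`).
--
-- Existence amounts to finite generation: the consequence cone must be an ideal plus a finitely
-- generated convex cone. Sets of this kind are stable under preimages along algebra homomorphisms
-- and under intersections. Existential quantifiers become preimages and disjunctions become
-- intersections, which leaves a single conjunction of literals. If it is satisfiable, its
-- consequences form the least cone that contains the asserted polynomials, is closed under cutting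
-- planes, and whose invertible elements form an ideal. Dividing by that ideal gives a generic model
-- of the conjunction in which nothing else is nonnegative (`isAlgCone_cubeCone`).
--
-- Modulo the ideal, it remains to see that the cutting-plane closure of a finite set is finitely
-- generated (`ConeCutClosed.exists_finset_hull`). Clearing denominators turns this into a question
-- about a submonoid `K` of a finitely generated group with a unit `e`. A cut-closed `K` without
-- `-e` has an integer point (`IsCutClosed.exists_hom_nonneg`). By Dickson's lemma, the integer
-- points have finitely many minimal ones; nonnegativity at these, together with a boundedness
-- condition, describes `K` (`IsCutClosed.exists_finset_generators`).

universe u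

namespace LIRing

/-! ### Rational convex cones: Farkas' lemma and preimages of finitely generated cones. -/

section Cones

variable {V W : Type*} [AddCommGroup V] [Module ℚ V] [AddCommGroup W] [Module ℚ W]

theorem hull_mem_of_nsmul_mem (C : PointedCone ℚ V) {n : ℕ} (hn : 1 ≤ n) {x : V}
    (hx : n • x ∈ C) : x ∈ C := by
  have h := PointedCone.smul_mem C (r := (n : ℚ)⁻¹) (by positivity) hx
  have hn' : (n : ℚ) ≠ 0 := by positivity
  rwa [← Nat.cast_smul_eq_nsmul ℚ, smul_smul, inv_mul_cancel₀ hn', one_smul] at h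

/-- Every element of a convex cone has a positive integer multiple in the monoid generated by
the same elements. -/
theorem exists_nsmul_mem_closure {s : Set V} {x : V} (hx : x ∈ PointedCone.hull ℚ s) :
    ∃ n : ℕ, 1 ≤ n ∧ n • x ∈ AddSubmonoid.closure s := by
  induction hx using Submodule.span_induction with
  | mem x h => exact ⟨1, le_rfl, by simpa using AddSubmonoid.subset_closure h⟩
  | zero => exact ⟨1, le_rfl, by simp⟩
  | add x y _ _ hx hy =>
    obtain ⟨m, hm, hx⟩ := hx
    obtain ⟨n, hn, hy⟩ := hy
    refine ⟨n * m, Nat.mul_pos hn hm, ?_⟩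
    have : (n * m) • (x + y) = n • (m • x) + m • (n • y) := by
      rw [smul_add, mul_smul, mul_comm n m, mul_smul]
    rw [this]
    exact add_mem (AddSubmonoid.nsmul_mem _ hx _) (AddSubmonoid.nsmul_mem _ hy _)
  | smul a x _ hx =>
    obtain ⟨m, hm, hx⟩ := hx
    obtain ⟨q, hq⟩ := a
    refine ⟨q.den * m, Nat.mul_pos q.pos hm, ?_⟩
    have : (q.den * m) • ((⟨q, hq⟩ : {c : ℚ // 0 ≤ c}) • x) = q.num.toNat • (m • x) := by
      have h1 : ((q.num.toNat : ℕ) : ℚ) = q.den * q := by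
        rw [Rat.den_mul_eq_num]
        exact_mod_cast Int.toNat_of_nonneg (Rat.num_nonneg.2 hq)
      change (q.den * m) • (q • x) = _
      rw [← Nat.cast_smul_eq_nsmul ℚ, ← Nat.cast_smul_eq_nsmul ℚ, ← Nat.cast_smul_eq_nsmul ℚ m,
        smul_smul, smul_smul, h1]
      congr 1
      push_cast
      ring
    rw [this]
    exact AddSubmonoid.nsmul_mem _ hx _

theorem closure_subset_hull (s : Set V) {x : V} (hx : x ∈ AddSubmonoid.closure s) :
    x ∈ PointedCone.hull ℚ s :=
  (AddSubmonoid.closure_le (S := (PointedCone.hull ℚ s).toAddSubmonoid)).2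
    PointedCone.subset_hull hx

theorem hull_mono {s t : Set V} (h : s ⊆ t) : PointedCone.hull ℚ s ≤ PointedCone.hull ℚ t :=
  Submodule.span_mono h

/-- **Farkas' lemma** over the rationals. -/
theorem exists_nonneg_neg_of_notMem_hull (s : Finset V) (w : V)
    (hw : w ∉ PointedCone.hull ℚ (s : Set V)) :
    ∃ ψ : V →ₗ[ℚ] ℚ, (∀ g ∈ s, 0 ≤ ψ g) ∧ ψ w < 0 := by
  classical
  -- Quantifying over `f` and `w` keeps the space fixed: the induction step projects along one
  -- generator, replacing `f` by `π.comp f` and `w` by `π w`.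
  suffices H : ∀ (f : V →ₗ[ℚ] V) (w : V), w ∉ PointedCone.hull ℚ (f '' (s : Set V)) →
      ∃ ψ : V →ₗ[ℚ] ℚ, (∀ g ∈ s, 0 ≤ ψ (f g)) ∧ ψ w < 0 by
    simpa using H LinearMap.id w (by simpa using hw)
  clear hw w
  induction s using Finset.induction_on with
  | empty =>
    intro f w hw
    have hw0 : w ≠ 0 := by
      rintro rfl
      exact hw (zero_mem _)
    obtain ⟨ψ, hψ⟩ := not_forall.1 fun h => hw0 ((Module.forall_dual_apply_eq_zero_iff ℚ w).1 h)
    rcases lt_or_gt_of_ne hψ with h | h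
    · exact ⟨ψ, by simp, h⟩
    · exact ⟨-ψ, by simp, by simpa using h⟩
  | insert a s _ ih =>
    intro f w hw
    rw [Finset.coe_insert, Set.image_insert_eq] at hw
    obtain ⟨ψ, h1, h2⟩ := ih f w fun h => hw (hull_mono (Set.subset_insert _ _) h)
    by_cases ha : 0 ≤ ψ (f a)
    · exact ⟨ψ, by simpa using ⟨ha, h1⟩, h2⟩
    push Not at ha
    -- The projection onto the kernel of `ψ` along `f a`. As `ψ (f a) < 0`, it changes each `f g`
    -- with `ψ (f g) ≥ 0` by a nonnegative multiple of `f a`, while `w` is recovered from `π w` by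
    -- adding a nonnegative multiple of `f a`. So separating `π w` suffices, and `ψ'.comp π`
    -- vanishes at `f a`.
    let π : V →ₗ[ℚ] V := LinearMap.id - (LinearMap.toSpanSingleton ℚ V ((ψ (f a))⁻¹ • f a)).comp ψ
    have hπ : ∀ v, π v = v - (ψ v / ψ (f a)) • f a := by
      intro v
      simp [π, smul_smul, div_eq_mul_inv]
    obtain ⟨ψ', h1', h2'⟩ := ih (π.comp f) (π w) (by
      intro h
      apply hw
      have hd : 0 ≤ ψ w / ψ (f a) := div_nonneg_of_nonpos h2.le ha.le
      have h3 : π w ∈ PointedCone.hull ℚ (insert (f a) (f '' (s : Set V))) := by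
        have h4 : ∀ v ∈ PointedCone.hull ℚ ((π.comp f) '' (s : Set V)),
            v ∈ PointedCone.hull ℚ (insert (f a) (f '' (s : Set V))) := by
          intro v hv
          refine Submodule.span_le.2 ?_ hv
          rintro _ ⟨g, hg, rfl⟩
          rw [LinearMap.comp_apply, hπ, sub_eq_add_neg, ← neg_smul]
          refine add_mem (PointedCone.subset_hull (Set.mem_insert_of_mem _ ⟨g, hg, rfl⟩))
            (PointedCone.smul_mem _ ?_ (PointedCone.subset_hull (Set.mem_insert _ _)))
          exact neg_nonneg.2 (div_nonpos_of_nonneg_of_nonpos (h1 g hg) ha.le)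
        exact h4 _ h
      have : w = π w + (ψ w / ψ (f a)) • f a := by rw [hπ]; abel
      rw [this]
      exact add_mem h3 (PointedCone.smul_mem _ hd (PointedCone.subset_hull (Set.mem_insert _ _))))
    refine ⟨ψ'.comp π, ?_, h2'⟩
    intro g hg
    rcases Finset.mem_insert.1 hg with rfl | hg
    · rw [LinearMap.comp_apply, hπ, div_self ha.ne]
      simp
    · exact h1' g hg

/-- The preimage of the sum of a subspace and a finitely generated cone under a linear map is the
sum of the preimage of the subspace and a finitely generated cone. -/
theorem exists_finset_preimage_add_hull (f : W →ₗ[ℚ] V) (J : Submodule ℚ V) (P : Finset V) :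
    ∃ R : Finset W, f ⁻¹' ((J : Set V) + (PointedCone.hull ℚ (P : Set V) : Set V)) =
      (J.comap f : Set W) + (PointedCone.hull ℚ (R : Set W) : Set W) := by
  classical
  -- Coefficient vectors whose combination of `P` lies in the range of `f` modulo `J`. If `m` and `m
  -- + n` belong to `N`, so does `n`; such a submonoid of `P → ℕ` is finitely generated. Preimages
  -- under `f` of the combinations given by its generators, taken modulo `J`, form `R`.
  let N : AddSubmonoid (P → ℕ) :=
    { carrier := {n | ∃ s, f s - ∑ p, n p • (p : V) ∈ J}
      zero_mem' := ⟨0, by simp⟩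
      add_mem' := by
        rintro m n ⟨s, hs⟩ ⟨t, ht⟩
        refine ⟨s + t, ?_⟩
        have := add_mem hs ht
        simp only [map_add, Pi.add_apply, add_smul, Finset.sum_add_distrib]
        convert this using 1
        abel }
  have hN : N.FG := by
    apply AddSubmonoid.fg_of_subtractive
    rintro m ⟨s, hs⟩ n ⟨t, ht⟩
    refine ⟨t - s, ?_⟩
    have := sub_mem ht hs
    simp only [Pi.add_apply, add_smul, Finset.sum_add_distrib] at this
    rw [map_sub]
    convert this using 1
    abel
  obtain ⟨T, hT⟩ := hN
  have hTN : ∀ n ∈ T, ∃ s, f s - ∑ p, n p • (p : V) ∈ J := fun n hn =>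
    (hT ▸ AddSubmonoid.subset_closure hn : n ∈ N)
  choose! σ hσ using hTN
  refine ⟨T.image σ, ?_⟩
  ext x
  simp only [Set.mem_preimage, Set.mem_add, SetLike.mem_coe, Submodule.mem_comap]
  constructor
  · rintro ⟨j, hj, c, hc, hjc⟩
    obtain ⟨N0, hN0, hcl⟩ := exists_nsmul_mem_closure hc
    rw [AddSubmonoid.mem_closure_finset] at hcl
    obtain ⟨n, -, hn⟩ := hcl
    have hmem : (fun p : P => n p) ∈ N := by
      refine ⟨N0 • x, ?_⟩
      have : ∑ p : P, n p • (p : V) = N0 • c := by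
        rw [← hn]
        exact Finset.sum_coe_sort P (fun p => n p • p)
      rw [this, map_nsmul, ← hjc, smul_add, add_sub_cancel_right]
      exact J.smul_of_tower_mem N0 hj
    have key : ∀ m ∈ AddSubmonoid.closure (T : Set (P → ℕ)),
        ∃ r ∈ PointedCone.hull ℚ ((T.image σ : Finset W) : Set W),
          f r - ∑ p, m p • (p : V) ∈ J := by
      intro m hm
      induction hm using AddSubmonoid.closure_induction with
      | mem m h =>
        exact ⟨σ m, PointedCone.subset_hull (by simpa using ⟨m, h, rfl⟩), hσ m h⟩
      | zero => exact ⟨0, zero_mem _, by simp⟩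
      | add m n _ _ hm hn =>
        obtain ⟨r, hr, hr'⟩ := hm
        obtain ⟨s, hs, hs'⟩ := hn
        refine ⟨r + s, add_mem hr hs, ?_⟩
        have := add_mem hr' hs'
        simp only [map_add, Pi.add_apply, add_smul, Finset.sum_add_distrib]
        convert this using 1
        abel
    obtain ⟨r, hr, hrJ⟩ := key _ (hT ▸ hmem)
    have h5 : f (N0 • x) - f r ∈ J := by
      have h6 : ∑ p : P, n p • (p : V) = N0 • c := by
        rw [← hn]
        exact Finset.sum_coe_sort P (fun p => n p • p)
      rw [h6] at hrJ
      have h7 : f (N0 • x) - f r = N0 • j - (f r - N0 • c) := by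
        rw [map_nsmul, ← hjc, smul_add]; abel
      rw [h7]
      exact sub_mem (J.smul_of_tower_mem N0 hj) hrJ
    have hN0' : (N0 : ℚ) ≠ 0 := by positivity
    -- `N0 • x` and `r` have the same image modulo `J`; division by `N0` undoes the clearing of
    -- denominators.
    refine ⟨x - (N0 : ℚ)⁻¹ • r, ?_, (N0 : ℚ)⁻¹ • r,
      PointedCone.smul_mem _ (by positivity) hr, by abel⟩
    have h8 := J.smul_mem (N0 : ℚ)⁻¹ h5
    rwa [← map_sub, ← map_smul, smul_sub, ← Nat.cast_smul_eq_nsmul ℚ, smul_smul,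
      inv_mul_cancel₀ hN0', one_smul] at h8
  · rintro ⟨j, hj, r, hr, rfl⟩
    have key : ∀ r ∈ PointedCone.hull ℚ ((T.image σ : Finset W) : Set W),
        ∃ c ∈ PointedCone.hull ℚ (P : Set V), f r - c ∈ J := by
      intro r hr
      induction hr using Submodule.span_induction with
      | mem r h =>
        simp only [Finset.coe_image, Set.mem_image, Finset.mem_coe] at h
        obtain ⟨m, hm, rfl⟩ := h
        refine ⟨_, ?_, hσ m hm⟩
        exact sum_mem fun p _ => AddSubmonoid.nsmul_mem (PointedCone.hull ℚ (P : Set V)).toAddSubmonoid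
          (PointedCone.subset_hull p.2) _
      | zero => exact ⟨0, zero_mem _, by simp⟩
      | add x y _ _ hx hy =>
        obtain ⟨c, hc, hx⟩ := hx
        obtain ⟨d, hd, hy⟩ := hy
        refine ⟨c + d, add_mem hc hd, ?_⟩
        rw [map_add, add_sub_add_comm]
        exact add_mem hx hy
      | smul a x _ hx =>
        obtain ⟨c, hc, hx⟩ := hx
        refine ⟨a • c, Submodule.smul_mem _ _ hc, ?_⟩
        have : f (a • x) - a • c = (a : ℚ) • (f x - c) := by
          rw [smul_sub, ← map_smul]; rfl
        rw [this]
        exact J.smul_mem _ hx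
    obtain ⟨c, hc, hcJ⟩ := key r hr
    refine ⟨f j + (f r - c), add_mem hj hcJ, c, hc, by rw [map_add]; abel⟩

end Cones

/-! ### Cut-closed submonoids of finitely generated groups and their integer points. -/

section Lattice

variable {L : Type*} [AddCommGroup L]

/-- A submonoid is closed under cutting planes with respect to `e` if `n x + m e ∈ K` implies
`x + ⌊m / n⌋ e ∈ K`. -/
def IsCutClosed (e : L) (K : AddSubmonoid L) : Prop :=
  ∀ (x : L) (n : ℕ) (m : ℤ), 1 ≤ n → n • x + m • e ∈ K → x + (m / (n : ℤ)) • e ∈ K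

theorem IsCutClosed.of_nsmul_mem {e : L} {K : AddSubmonoid L} (hK : IsCutClosed e K) {n : ℕ}
    (hn : 1 ≤ n) {x : L} (hx : n • x ∈ K) : x ∈ K := by
  simpa using hK x n 0 hn (by simpa using hx)

theorem add_zsmul_mem_of_le {e : L} {K : AddSubmonoid L} (he : e ∈ K) {x : L} {c d : ℤ}
    (hcd : c ≤ d) (hx : x + c • e ∈ K) : x + d • e ∈ K := by
  obtain ⟨k, rfl⟩ := Int.le.dest hcd
  rw [add_smul, ← add_assoc, natCast_zsmul]
  exact add_mem hx (AddSubmonoid.nsmul_mem _ he _)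

/-- The nonnegativity set of a homomorphism that maps `e` to `1` is closed under cutting planes. -/
def homNonneg (φ : L →+ ℤ) : AddSubmonoid L where
  carrier := {x | 0 ≤ φ x}
  zero_mem' := by simp
  add_mem' := fun {x y} hx hy => by
    simp only [Set.mem_ofPred_eq, map_add] at *
    exact add_nonneg hx hy

theorem mem_homNonneg {φ : L →+ ℤ} {x : L} : x ∈ homNonneg φ ↔ 0 ≤ φ x := Iff.rfl

/-- The values of `φ` are integers, so the bound `-φ x ≤ m / n` may be rounded down. This is the
soundness of cutting planes at integer points. -/
theorem isCutClosed_homNonneg {φ : L →+ ℤ} {e : L} (he : φ e = 1) :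
    IsCutClosed e (homNonneg φ) := by
  intro x n m hn h
  rw [mem_homNonneg] at *
  simp only [map_add, map_nsmul, map_zsmul, he, smul_eq_mul, nsmul_eq_mul, mul_one] at *
  have hn' : (0 : ℤ) < n := by exact_mod_cast hn
  have h1 : -φ x ≤ m / (n : ℤ) := by
    rw [Int.le_ediv_iff_mul_le hn']
    linarith
  linarith

/-- The submonoid of all `y` with `y + k x ∈ K` for some `k`. -/
def shiftMonoid (K : AddSubmonoid L) (x : L) : AddSubmonoid L where
  carrier := {y | ∃ k : ℕ, y + k • x ∈ K}
  zero_mem' := ⟨0, by simp⟩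
  add_mem' := by
    rintro y z ⟨k, hk⟩ ⟨l, hl⟩
    refine ⟨k + l, ?_⟩
    rw [show y + z + (k + l) • x = y + k • x + (z + l • x) by rw [add_smul]; abel]
    exact add_mem hk hl

theorem le_shiftMonoid (K : AddSubmonoid L) (x : L) : K ≤ shiftMonoid K x :=
  fun y hy => ⟨0, by simpa using hy⟩

theorem neg_mem_shiftMonoid (K : AddSubmonoid L) (x : L) : -x ∈ shiftMonoid K x :=
  ⟨1, by simp⟩

/-- Adding `(n - 1) * k` further copies of `x ∈ K` makes the coefficient of `x` equal to `n * k`, so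
the cut can be made in `K` at `y + k • x`. -/
theorem IsCutClosed.shift {K : AddSubmonoid L} {e : L} (hK : IsCutClosed e K) {x : L}
    (hx : x ∈ K) : IsCutClosed e (shiftMonoid K x) := by
  rintro y n m hn ⟨k, hk⟩
  refine ⟨k, ?_⟩
  have h1 : n • (y + k • x) + m • e ∈ K := by
    have : n • (y + k • x) + m • e = n • y + m • e + k • x + ((n - 1) * k) • x := by
      obtain ⟨n, rfl⟩ : ∃ n', n = n' + 1 := ⟨n - 1, by omega⟩
      rw [Nat.add_sub_cancel, smul_add, smul_smul, add_mul, add_smul (n * k), one_mul]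
      abel
    rw [this]
    exact add_mem hk (AddSubmonoid.nsmul_mem _ hx _)
  have := hK _ _ _ hn h1
  rwa [add_right_comm] at this

/-- Making `x` invertible stays consistent: if `k • x - e ∈ K` with `k ≥ 1`, the cut with `⌊-1 / k⌋
= -1` would give `x - e ∈ K`. -/
theorem IsCutClosed.neg_notMem_shiftMonoid {K : AddSubmonoid L} {e : L} (hK : IsCutClosed e K)
    (he : -e ∉ K) {x : L} (hxe : x - e ∉ K) : -e ∉ shiftMonoid K x := by
  rintro ⟨k, hk⟩
  rcases Nat.eq_zero_or_pos k with rfl | hk0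
  · exact he (by simpa using hk)
  · apply hxe
    have := hK x k (-1) hk0 (by simpa [add_comm] using hk)
    have h2 : (-1 : ℤ) / (k : ℤ) = -1 :=
      Int.ediv_eq_neg_one_of_neg_of_le (by norm_num) (by omega)
    rwa [h2, neg_one_smul, ← sub_eq_add_neg] at this

/-- The subgroup of invertible elements of a submonoid of a commutative group. -/
def unitsModule (K : AddSubmonoid L) : Submodule ℤ L :=
  AddSubgroup.toIntSubmodule
    { carrier := {x | x ∈ K ∧ -x ∈ K}
      zero_mem' := by simp
      add_mem' := by
        rintro x y ⟨h1, h2⟩ ⟨h3, h4⟩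
        exact ⟨add_mem h1 h3, by rw [neg_add]; exact add_mem h2 h4⟩
      neg_mem' := by
        rintro x ⟨h1, h2⟩
        exact ⟨h2, by simpa using h1⟩ }

/-- There is a homomorphism to the integers that vanishes on the units and maps `e` to `1`. -/
theorem IsCutClosed.exists_hom_units [Module.Finite ℤ L] {K : AddSubmonoid L} {e : L}
    (hK : IsCutClosed e K) (hne : -e ∉ K) :
    ∃ φ : L →+ ℤ, φ e = 1 ∧ ∀ u ∈ unitsModule K, φ u = 0 := by
  let Q := L ⧸ unitsModule K
  -- Cuts with `m = 0` allow division by positive integers in `K`, hence among its units.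
  have htf : Module.IsTorsionFree ℤ Q := by
    rw [Module.isTorsionFree_iff_smul_eq_zero]
    intro r q hq
    obtain ⟨y, rfl⟩ := Submodule.Quotient.mk_surjective _ q
    rw [← Submodule.Quotient.mk_smul, Submodule.Quotient.mk_eq_zero] at hq
    rw [Submodule.Quotient.mk_eq_zero]
    by_cases hr : r = 0
    · exact Or.inl hr
    right
    have hq' : r.natAbs • y ∈ unitsModule K := by
      rcases Int.natAbs_eq r with h | h
      · rwa [h, natCast_zsmul] at hq
      · rw [h, neg_smul, natCast_zsmul] at hq
        simpa using neg_mem hq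
    have hr' : 1 ≤ r.natAbs := Nat.pos_of_ne_zero (by simpa using hr)
    refine ⟨hK.of_nsmul_mem hr' hq'.1, hK.of_nsmul_mem hr' ?_⟩
    rw [smul_neg]
    exact hq'.2
  have hfree : Module.Free ℤ Q := Module.free_of_finite_type_torsion_free'
  let b := Module.Free.chooseBasis ℤ Q
  let q : Q := Submodule.Quotient.mk e
  -- `d` generates the ideal of values at `q` of all integer functionals. It divides every
  -- coordinate of `q`, so `q` is a multiple `d • _`; what remains is to show `d = ±1`.
  obtain ⟨d, hd⟩ := (IsPrincipalIdealRing.principal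
    (LinearMap.range (Module.Dual.eval ℤ Q q))).principal
  have hmem : d ∈ LinearMap.range (Module.Dual.eval ℤ Q q) := by
    rw [hd]
    exact Submodule.mem_span_singleton_self d
  obtain ⟨f, hf⟩ := hmem
  rw [Module.Dual.eval_apply] at hf
  have hdvd : ∀ i, ∃ c, b.repr q i = d * c := by
    intro i
    have : b.repr q i ∈ LinearMap.range (Module.Dual.eval ℤ Q q) := ⟨b.coord i, rfl⟩
    rw [hd, Submodule.mem_span_singleton] at this
    obtain ⟨c, hc⟩ := this
    exact ⟨c, by rw [← hc, smul_eq_mul, mul_comm]⟩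
  choose c hc using hdvd
  have hq : q = d • ∑ i, c i • b i := by
    rw [← b.sum_repr q, Finset.smul_sum]
    exact Finset.sum_congr rfl fun i _ => by rw [hc i, mul_smul]
  obtain ⟨y, hy⟩ := Submodule.Quotient.mk_surjective _ (∑ i, c i • b i)
  -- The class of `e` is primitive: cutting `n • z - e ∈ K` gives `z - e ∈ K`, and subtracting the
  -- unit `n • z - e` from `n • (z - e)` leaves `-(n - 1) • e`, which would put `-e` into `K` if `n
  -- > 1`.
  have hed : ∀ z : L, ∀ n : ℕ, n • z - e ∈ unitsModule K → n = 1 := by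
    intro z n hz
    have hn : 1 ≤ n := by
      rcases Nat.eq_zero_or_pos n with rfl | h
      · exact absurd (by simpa using hz.1) hne
      · exact h
    have h1 := hK z n (-1) hn (by simpa [sub_eq_add_neg] using hz.1)
    have h2 : (-1 : ℤ) / (n : ℤ) = -1 :=
      Int.ediv_eq_neg_one_of_neg_of_le (by norm_num) (by omega)
    rw [h2] at h1
    have h3 := add_mem (AddSubmonoid.nsmul_mem _ h1 n) hz.2
    by_contra hn1
    refine hne (hK.of_nsmul_mem (n := n - 1) (by omega) ?_)
    have h4 : n • (z + (-1 : ℤ) • e) + -(n • z - e) = (n - 1) • -e := by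
      obtain ⟨n, rfl⟩ : ∃ n', n = n' + 1 := ⟨n - 1, by omega⟩
      rw [Nat.add_sub_cancel, neg_one_smul, smul_add, smul_neg, smul_neg, add_smul n 1 e]
      abel
    rwa [h4] at h3
  have hdy : d • y - e ∈ unitsModule K := by
    rw [← Submodule.Quotient.mk_eq_zero, Submodule.Quotient.mk_sub, Submodule.Quotient.mk_smul, hy,
      ← hq, sub_self]
  have hφ : ∀ g : Q →ₗ[ℤ] ℤ, g q = 1 →
      ∃ φ : L →+ ℤ, φ e = 1 ∧ ∀ u ∈ unitsModule K, φ u = 0 := by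
    intro g hg
    refine ⟨(g.comp (unitsModule K).mkQ).toAddMonoidHom, hg, fun u hu => ?_⟩
    have : (unitsModule K).mkQ u = 0 := (Submodule.Quotient.mk_eq_zero _).2 hu
    simp [this]
  rcases Int.natAbs_eq d with h | h
  · have h1 := hed y d.natAbs (by rwa [h, natCast_zsmul] at hdy)
    rw [h1] at h
    exact hφ f (by rw [hf, h]; rfl)
  · have h1 := hed (-y) d.natAbs (by
      rw [h, neg_smul, natCast_zsmul] at hdy
      rwa [smul_neg])
    rw [h1] at h
    exact hφ (-f) (by rw [LinearMap.neg_apply, hf, h]; rfl)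

/-- A rational-valued homomorphism on a finitely generated group has an integer-valued positive
multiple. -/
theorem exists_int_multiple [Module.Finite ℤ L] (f : L →+ ℚ) :
    ∃ (D : ℕ) (θ : L →+ ℤ), 1 ≤ D ∧ ∀ x, (θ x : ℚ) = D * f x := by
  classical
  obtain ⟨T, hT⟩ := (Module.Finite.fg_top : (⊤ : Submodule ℤ L).FG)
  let D : ℕ := ∏ t ∈ T, (f t).den
  have hD : ∀ x, ∃ k : ℤ, (k : ℚ) = D * f x := by
    intro x
    have hx : x ∈ Submodule.span ℤ (T : Set L) := hT ▸ Submodule.mem_top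
    induction hx using Submodule.span_induction with
    | mem x h =>
      obtain ⟨k, hk⟩ := Finset.dvd_prod_of_mem (fun t => (f t).den) h
      refine ⟨k * (f x).num, ?_⟩
      push_cast
      rw [show (D : ℚ) = (f x).den * k by exact_mod_cast hk, mul_right_comm, Rat.den_mul_eq_num,
        mul_comm]
    | zero => exact ⟨0, by simp⟩
    | add x y _ _ hx hy =>
      obtain ⟨k, hk⟩ := hx
      obtain ⟨l, hl⟩ := hy
      exact ⟨k + l, by push_cast; rw [hk, hl, map_add, mul_add]⟩
    | smul a x _ hx =>
      obtain ⟨k, hk⟩ := hx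
      exact ⟨a * k, by push_cast; rw [hk, map_zsmul, zsmul_eq_mul]; ring⟩
  choose θ hθ using hD
  refine ⟨D, ⟨⟨θ, ?_⟩, ?_⟩, Finset.prod_pos fun t _ => (f t).pos, hθ⟩
  · have := hθ 0
    rw [map_zero, mul_zero] at this
    exact_mod_cast this
  · intro x y
    have : ((θ (x + y) : ℤ) : ℚ) = ((θ x + θ y : ℤ) : ℚ) := by
      push_cast
      rw [hθ, hθ, hθ, map_add, mul_add]
    exact_mod_cast this

theorem closure_image_of_injective {V : Type*} [AddCommGroup V] (ι : L →+ V) (hι : Function.Injective ι) (s : Set L) {x : L}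
    (hx : ι x ∈ AddSubmonoid.closure (ι '' s)) : x ∈ AddSubmonoid.closure s := by
  rw [← AddMonoidHom.map_mclosure] at hx
  obtain ⟨y, hy, hxy⟩ := hx
  exact hι hxy ▸ hy

variable {V : Type*} [AddCommGroup V] [Module ℚ V]

/-- A cut-closed submonoid that does not contain `-e` has an integer point: a homomorphism to the
integers that maps `e` to `1` and is nonnegative on a given finite subset. -/
theorem IsCutClosed.exists_hom_nonneg [Module.Finite ℤ L] (ι : L →+ V)
    (hι : Function.Injective ι) {e : L} (K : AddSubmonoid L) (G : Finset L)
    (hK : IsCutClosed e K) (he : e ∈ K) (hne : -e ∉ K) (hG : ∀ g ∈ G, g ∈ K) :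
    ∃ φ : L →+ ℤ, φ e = 1 ∧ ∀ g ∈ G, 0 ≤ φ g := by
  classical
  -- The induction enlarges the group of units of `K`, which terminates because `L` is Noetherian.
  have hwf : WellFoundedGT (Submodule ℤ L) := inferInstance
  generalize hU : unitsModule K = U
  induction U using hwf.induction generalizing K G with
  | ind U ih =>
  -- Such an `x` can be set to zero by passing to `shiftMonoid K x`, with strictly more units. If
  -- none is left, each element of `K` is a unit or stays in `K` after subtracting `e`.
  by_cases hx : ∃ x ∈ K, x - e ∉ K ∧ -x ∉ K
  · obtain ⟨x, hxK, hxe, hxn⟩ := hx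
    obtain ⟨φ, h1, h2⟩ := ih (unitsModule (shiftMonoid K x)) (by
      rw [← hU]
      refine lt_of_le_of_ne (fun y hy => ⟨le_shiftMonoid K x hy.1, le_shiftMonoid K x hy.2⟩) ?_
      intro heq
      have : x ∈ unitsModule (shiftMonoid K x) :=
        ⟨le_shiftMonoid K x hxK, neg_mem_shiftMonoid K x⟩
      rw [← heq] at this
      exact hxn this.2) (shiftMonoid K x) G (hK.shift hxK) (le_shiftMonoid K x he)
      (hK.neg_notMem_shiftMonoid hne hxe) (fun g hg => le_shiftMonoid K x (hG g hg)) rfl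
    exact ⟨φ, h1, h2⟩
  push Not at hx
  obtain ⟨φ, hφe, hφu⟩ := hK.exists_hom_units hne
  have hψ : ∀ g ∈ G, φ g < 0 → ∃ ψ : V →ₗ[ℚ] ℚ, (∀ h ∈ G, 0 ≤ ψ (ι h)) ∧ ψ (ι e) = 0 ∧
      0 < ψ (ι g) := by
    intro g hg hg0
    -- The element `g` is infinitely large compared with `e`: if subtraction of `e` first failed
    -- after `n` steps, `g - n • e` would be a unit, forcing `φ g = n ≥ 0`.
    have hbad : ∀ n : ℕ, g + (-(n : ℤ)) • e ∈ K := by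
      intro n
      induction n with
      | zero => simpa using hG g hg
      | succ n ihn =>
        by_contra hcon
        have hu : g + (-(n : ℤ)) • e ∈ unitsModule K := ⟨ihn, hx _ ihn (by
          intro h
          apply hcon
          convert h using 1
          push_cast
          rw [neg_add, add_smul, neg_one_smul]
          abel)⟩
        have h0 := hφu _ hu
        rw [map_add, map_zsmul, hφe] at h0
        simp at h0
        omega
    -- Otherwise a cut would bound `g` above by a multiple of `e`, contradicting `hbad`. Having both
    -- `e` and `-e` among the generators forces the functional from Farkas' lemma to vanish at `e`.
    have hnot : ι (-g) ∉ PointedCone.hull ℚ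
        (((insert e (insert (-e) G)).image ι : Finset V) : Set V) := by
      intro hmem
      obtain ⟨k, hk, hkm⟩ := exists_nsmul_mem_closure hmem
      rw [← map_nsmul, Finset.coe_image] at hkm
      have hcl := closure_image_of_injective ι hι _ hkm
      have hred : ∀ z ∈ AddSubmonoid.closure ((insert e (insert (-e) G) : Finset L) : Set L),
          ∃ c : ℤ, z + c • e ∈ K := by
        intro z hz
        induction hz using AddSubmonoid.closure_induction with
        | mem z h =>
          simp only [Finset.coe_insert, Set.mem_insert_iff, Finset.mem_coe] at h
          rcases h with rfl | rfl | h
          · exact ⟨0, by simpa using he⟩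
          · exact ⟨1, by simp⟩
          · exact ⟨0, by simpa using hG z h⟩
        | zero => exact ⟨0, by simp⟩
        | add y z _ _ hy hz =>
          obtain ⟨c, hc⟩ := hy
          obtain ⟨d, hd⟩ := hz
          refine ⟨c + d, ?_⟩
          rw [add_smul, add_add_add_comm]
          exact add_mem hc hd
      obtain ⟨c, hc⟩ := hred _ hcl
      have h1 := hK _ _ _ hk hc
      have h2 := add_mem h1 (hbad ((c / (k : ℤ)).toNat + 1))
      have h3 : -g + (c / (k : ℤ)) • e + (g + (-(((c / (k : ℤ)).toNat + 1 : ℕ) : ℤ)) • e) =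
          0 + (c / (k : ℤ) - (((c / (k : ℤ)).toNat + 1 : ℕ) : ℤ)) • e := by
        rw [sub_smul, neg_smul]
        abel
      rw [h3] at h2
      have h4 := add_zsmul_mem_of_le he (d := -1) (by omega) h2
      exact hne (by simpa using h4)
    obtain ⟨ψ, h1, h2⟩ := exists_nonneg_neg_of_notMem_hull _ _ hnot
    refine ⟨ψ, fun h hh => h1 _ ?_, le_antisymm ?_ ?_, ?_⟩
    · exact Finset.mem_image_of_mem _ (by simp [hh])
    · have := h1 (ι (-e)) (Finset.mem_image_of_mem _ (by simp))
      simpa using this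
    · exact h1 (ι e) (Finset.mem_image_of_mem _ (by simp))
    · simpa using h2
  choose! ψ hψ1 hψ2 hψ3 using hψ
  let B := G.filter fun g => φ g < 0
  let Ψ : V →ₗ[ℚ] ℚ := ∑ g ∈ B, ψ g
  have hB : ∀ {g}, g ∈ B → g ∈ G ∧ φ g < 0 := fun h => by simpa [B] using h
  have hΨ : ∀ x, Ψ x = ∑ g ∈ B, ψ g x := fun x => by simp [Ψ]
  have hΨG : ∀ g ∈ G, 0 ≤ Ψ (ι g) := fun g hg => by
    rw [hΨ]
    exact Finset.sum_nonneg fun h hh => hψ1 h (hB hh).1 (hB hh).2 g hg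
  have hΨe : Ψ (ι e) = 0 := by
    rw [hΨ]
    exact Finset.sum_eq_zero fun h hh => hψ2 h (hB hh).1 (hB hh).2
  have hΨB : ∀ g ∈ B, 0 < Ψ (ι g) := fun g hg => by
    rw [hΨ]
    exact Finset.sum_pos' (fun h hh => hψ1 h (hB hh).1 (hB hh).2 g (hB hg).1)
      ⟨g, hg, hψ3 g (hB hg).1 (hB hg).2⟩
  obtain ⟨D, θ, hD, hθ⟩ := exists_int_multiple (Ψ.toAddMonoidHom.comp ι)
  have hD' : (0 : ℚ) < D := by exact_mod_cast hD
  simp only [AddMonoidHom.comp_apply, LinearMap.toAddMonoidHom_coe] at hθ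
  -- `θ` vanishes at `e`, is nonnegative on `G`, and is at least `1` where `φ` is negative; the
  -- factor bounds every `|φ g|`, so the correction repairs all bad values at once.
  refine ⟨φ + (∑ g ∈ G, |φ g|) • θ, ?_, ?_⟩
  · have : θ e = 0 := by
      have := hθ e
      rw [hΨe, mul_zero] at this
      exact_mod_cast this
    simp [hφe, this]
  · intro g hg
    rw [AddMonoidHom.add_apply, AddMonoidHom.smul_apply, smul_eq_mul]
    have hsum : |φ g| ≤ ∑ g ∈ G, |φ g| :=
      Finset.single_le_sum (f := fun g => |φ g|) (fun _ _ => abs_nonneg _) hg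
    have hθg : 0 ≤ θ g := by
      have := hθ g
      have h2 := mul_nonneg hD'.le (hΨG g hg)
      rw [← this] at h2
      exact_mod_cast h2
    have hS : 0 ≤ ∑ g ∈ G, |φ g| := (abs_nonneg _).trans hsum
    by_cases h0 : φ g < 0
    · have h1 : 0 < θ g := by
        have := hθ g
        have h2 := mul_pos hD' (hΨB g (by simp [B, hg, h0]))
        rw [← this] at h2
        exact_mod_cast h2
      have h3 := neg_abs_le (φ g)
      nlinarith
    · exact add_nonneg (not_lt.1 h0) (mul_nonneg hS hθg)

/-- The least cut-closed submonoid that contains a given finite set with `e` among its members is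
finitely generated up to multiples. -/
theorem IsCutClosed.exists_finset_generators [Module.Finite ℤ L] (ι : L →+ V)
    (hι : Function.Injective ι) {e : L} (K : AddSubmonoid L) (G : Finset L)
    (hK : IsCutClosed e K) (heG : e ∈ G) (hne : -e ∉ K) (hG : ∀ g ∈ G, g ∈ K)
    (hmin : ∀ K' : AddSubmonoid L, IsCutClosed e K' → (∀ g ∈ G, g ∈ K') → K ≤ K') :
    ∃ R : Finset L, (∀ r ∈ R, r ∈ K) ∧
      ∀ x ∈ K, ∃ n : ℕ, 1 ≤ n ∧ n • x ∈ AddSubmonoid.closure (R : Set L) := by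
  classical
  have he : e ∈ K := hG e heG
  let Φ : Set (L →+ ℤ) := {φ | φ e = 1 ∧ ∀ g ∈ G, 0 ≤ φ g}
  have hΦK : ∀ φ ∈ Φ, ∀ x ∈ K, 0 ≤ φ x := fun φ hφ x hx =>
    hmin (homNonneg φ) (isCutClosed_homNonneg hφ.1) hφ.2 hx
  let F : (L →+ ℤ) → (G → ℕ) := fun φ g => (φ g).toNat
  -- The minimal value vectors of integer points form an antichain in `G → ℕ`, finite by Dickson's
  -- lemma.
  let S : Set (G → ℕ) := {n | Minimal (· ∈ F '' Φ) n}
  have hSfin : S.Finite := (setOfPred_minimal_antichain _).finite_of_partiallyWellOrderedOn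
    (Set.isPWO_of_wellQuasiOrderedLE S)
  have : Fintype S := hSfin.fintype
  have hSΦ : ∀ n : S, ∃ φ ∈ Φ, F φ = n := fun n => n.2.1
  choose φ hφΦ hφF using hSΦ
  have hdom : ∀ χ ∈ Φ, ∃ j : S, ∀ g ∈ G, φ j g ≤ χ g := by
    intro χ hχ
    obtain ⟨n, hn, hnmin⟩ := exists_minimal_le_of_wellFoundedLT (· ∈ F '' Φ) (F χ) ⟨χ, hχ, rfl⟩
    refine ⟨⟨n, hnmin⟩, fun g hg => ?_⟩
    have h1 := hn ⟨g, hg⟩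
    have h2 := congrFun (hφF ⟨n, hnmin⟩) ⟨g, hg⟩
    simp only [F] at h1 h2
    have h3 := (hφΦ ⟨n, hnmin⟩).2 g hg
    have h4 := hχ.2 g hg
    omega
  -- The minimal integer points test membership in `K` for elements bounded below by a multiple of
  -- `e`. If `x ∉ K`, let `k` be least with `x + k • e ∈ K`; an integer point `χ` of the monoid with
  -- `x + k • e` made invertible satisfies `χ x ≤ -k < 0`. A minimal `φ j` below `χ` on `G` then has
  -- `φ j x ≤ χ x`, as `n • x + c • e` is a sum of elements of `G`.
  have hchar : ∀ (x : L) (n : ℕ) (c : ℤ), 1 ≤ n → n • x + c • e ∈ AddSubmonoid.closure (G : Set L) →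
      (∀ j, 0 ≤ φ j x) → x ∈ K := by
    intro x n c hn hcl hx
    have hGK : AddSubmonoid.closure (G : Set L) ≤ K := AddSubmonoid.closure_le.2 hG
    have h1 := hK x n c hn (hGK hcl)
    by_contra hxK
    have hex : ∃ k : ℕ, x + (k : ℤ) • e ∈ K :=
      ⟨(c / (n : ℤ)).toNat, add_zsmul_mem_of_le he (by omega) h1⟩
    let k := Nat.find hex
    have hk : x + (k : ℤ) • e ∈ K := Nat.find_spec hex
    have hk0 : k ≠ 0 := by
      intro h0
      rw [h0] at hk
      exact hxK (by simpa using hk)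
    have hk1 : x + (k : ℤ) • e - e ∉ K := by
      have := Nat.find_min hex (m := k - 1) (by omega)
      intro h
      apply this
      convert h using 1
      rw [Nat.cast_sub (by omega), sub_smul]
      simp [add_sub_assoc]
    obtain ⟨χ, hχe, hχG⟩ := IsCutClosed.exists_hom_nonneg ι hι
      (shiftMonoid K (x + (k : ℤ) • e)) (insert (-(x + (k : ℤ) • e)) G)
      (hK.shift hk) (le_shiftMonoid K _ he) (hK.neg_notMem_shiftMonoid hne hk1) (by
        intro g hg
        rcases Finset.mem_insert.1 hg with rfl | hg
        · exact neg_mem_shiftMonoid K _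
        · exact le_shiftMonoid K _ (hG g hg))
    have hχ0 := hχG _ (Finset.mem_insert_self _ _)
    rw [map_neg, map_add, map_zsmul, hχe, smul_eq_mul, mul_one] at hχ0
    obtain ⟨j, hj⟩ := hdom χ ⟨hχe, fun g hg => hχG g (Finset.mem_insert_of_mem hg)⟩
    have hle : ∀ z ∈ AddSubmonoid.closure (G : Set L), φ j z ≤ χ z := by
      intro z hz
      induction hz using AddSubmonoid.closure_induction with
      | mem z h => exact hj z h
      | zero => simp
      | add y z _ _ hy hz =>
        rw [map_add, map_add]
        exact add_le_add hy hz
    have h5 := hle _ hcl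
    rw [map_add, map_add, map_nsmul, map_nsmul, map_zsmul, map_zsmul, hχe, (hφΦ j).1,
      nsmul_eq_mul, nsmul_eq_mul] at h5
    have h6 : φ j x ≤ χ x := le_of_mul_le_mul_left (by linarith) (by exact_mod_cast hn : (0 : ℤ) < n)
    have := hx j
    omega
  -- The elements bounded in this sense form a cut-closed submonoid containing `G`, so minimality of
  -- `K` applies.
  have hbdd : ∀ x ∈ K, ∃ (n : ℕ) (c : ℤ), 1 ≤ n ∧
      n • x + c • e ∈ AddSubmonoid.closure (G : Set L) := by
    let K' : AddSubmonoid L :=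
      { carrier := {x | ∃ (n : ℕ) (c : ℤ), 1 ≤ n ∧
          n • x + c • e ∈ AddSubmonoid.closure (G : Set L)}
        zero_mem' := ⟨1, 0, le_rfl, by simp⟩
        add_mem' := by
          rintro x y ⟨n, c, hn, hx⟩ ⟨m, d, hm, hy⟩
          refine ⟨n * m, m * c + n * d, Nat.mul_pos hn hm, ?_⟩
          have := add_mem (AddSubmonoid.nsmul_mem _ hx m) (AddSubmonoid.nsmul_mem _ hy n)
          convert this using 1
          simp only [← natCast_zsmul]
          push_cast
          module }
    refine hmin K' ?_ fun g hg => ⟨1, 0, le_rfl, by simpa using AddSubmonoid.subset_closure hg⟩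
    rintro x n m hn ⟨N, c, hN, hx⟩
    refine ⟨N * n, N * m + c - N * n * (m / (n : ℤ)), Nat.mul_pos hN hn, ?_⟩
    convert hx using 1
    simp only [← natCast_zsmul]
    push_cast
    module
  -- A triple records coefficients on `G`, a multiple of `e` to subtract, and slacks that witness
  -- nonnegativity at every `φ j`. Being solutions of linear equations in natural numbers, the
  -- triples form a finitely generated monoid.
  let M : AddSubmonoid (((G → ℕ) × ℕ) × (S → ℕ)) :=
    { carrier := {p | ∀ j, φ j (∑ g, p.1.1 g • (g : L)) = p.1.2 + p.2 j}
      zero_mem' := by simp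
      add_mem' := by
        rintro p q hp hq j
        simp only [Prod.fst_add, Prod.snd_add, Pi.add_apply, add_smul, Finset.sum_add_distrib,
          map_add, hp j, hq j]
        push_cast
        ring }
  have hM : M.FG := by
    apply AddSubmonoid.fg_of_subtractive
    rintro p hp q hq j
    have h1 := hp j
    have h2 := hq j
    simp only [Prod.fst_add, Prod.snd_add, Pi.add_apply, add_smul, Finset.sum_add_distrib,
      map_add] at h2
    rw [h1] at h2
    push_cast at h2
    linarith
  obtain ⟨T, hT⟩ := hM
  let ρ : (((G → ℕ) × ℕ) × (S → ℕ)) →+ L :=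
    { toFun := fun p => ∑ g, p.1.1 g • (g : L) - p.1.2 • e
      map_zero' := by simp
      map_add' := by
        intro p q
        simp only [Prod.fst_add, Prod.snd_add, Pi.add_apply, add_smul, Finset.sum_add_distrib]
        abel }
  have hρ : ∀ p, ρ p = ∑ g, p.1.1 g • (g : L) - p.1.2 • e := fun _ => rfl
  refine ⟨T.image ρ, ?_, ?_⟩
  · intro r hr
    obtain ⟨p, hp, rfl⟩ := Finset.mem_image.1 hr
    have hpM : p ∈ M := hT ▸ AddSubmonoid.subset_closure hp
    refine hchar (ρ p) 1 p.1.2 le_rfl ?_ ?_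
    · rw [one_smul, hρ, natCast_zsmul, sub_add_cancel]
      exact sum_mem fun g _ => AddSubmonoid.nsmul_mem _ (AddSubmonoid.subset_closure g.2) _
    · intro j
      rw [hρ, map_sub, hpM j, map_nsmul, (hφΦ j).1]
      simp
  · intro x hx
    obtain ⟨n, c, hn, hcl⟩ := hbdd x hx
    refine ⟨n, hn, ?_⟩
    have hcl' : n • x + (c.toNat : ℤ) • e ∈ AddSubmonoid.closure (G : Set L) :=
      add_zsmul_mem_of_le (AddSubmonoid.subset_closure heG) (by omega) hcl
    rw [AddSubmonoid.mem_closure_finset] at hcl'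
    obtain ⟨f, -, hf⟩ := hcl'
    have hsum : ∑ g : G, f g • (g : L) = n • x + (c.toNat : ℤ) • e := by
      rw [← hf]
      exact Finset.sum_coe_sort G (fun g => f g • g)
    let p : ((G → ℕ) × ℕ) × (S → ℕ) := ((fun g => f g, c.toNat), fun j => (n * φ j x).toNat)
    have hp : p ∈ M := by
      intro j
      have h0 : 0 ≤ (n : ℤ) * φ j x := mul_nonneg (by positivity) (hΦK _ (hφΦ j) x hx)
      simp only [p]
      rw [hsum, map_add, map_nsmul, map_zsmul, (hφΦ j).1, Int.toNat_of_nonneg h0, nsmul_eq_mul,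
        smul_eq_mul, mul_one, add_comm]
    have hpx : ρ p = n • x := by
      rw [hρ]
      simp only [p]
      rw [hsum, natCast_zsmul, add_sub_cancel_right]
    rw [← hpx, Finset.coe_image, ← AddMonoidHom.map_mclosure, hT]
    exact AddSubmonoid.mem_map_of_mem ρ hp

end Lattice

/-! ### Finite generation of the cutting-plane closure of a cone. -/

section CuttingPlanes

variable {V : Type*} [AddCommGroup V] [Module ℚ V]

/-- A convex cone is closed under cutting planes with respect to the integral elements `Λ` and
the unit `e`. -/
def ConeCutClosed (Λ : AddSubgroup V) (e : V) (C : PointedCone ℚ V) : Prop :=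
  ∀ x ∈ Λ, ∀ (n : ℕ) (m : ℤ), 1 ≤ n → n • x + m • e ∈ C → x + (m / (n : ℤ)) • e ∈ C

theorem exists_nsmul_mem_of_mem_span (Λ : AddSubgroup V) {x : V}
    (hx : x ∈ Submodule.span ℚ (Λ : Set V)) : ∃ n : ℕ, 1 ≤ n ∧ n • x ∈ Λ := by
  induction hx using Submodule.span_induction with
  | mem x h => exact ⟨1, le_rfl, by simpa using h⟩
  | zero => exact ⟨1, le_rfl, by simp⟩
  | add x y _ _ hx hy =>
    obtain ⟨m, hm, hx⟩ := hx
    obtain ⟨n, hn, hy⟩ := hy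
    refine ⟨n * m, Nat.mul_pos hn hm, ?_⟩
    have : (n * m) • (x + y) = n • (m • x) + m • (n • y) := by
      rw [smul_add, mul_smul, mul_comm n m, mul_smul]
    rw [this]
    exact add_mem (nsmul_mem hx _) (nsmul_mem hy _)
  | smul q x _ hx =>
    obtain ⟨m, hm, hx⟩ := hx
    refine ⟨q.den * m, Nat.mul_pos q.pos hm, ?_⟩
    have : (q.den * m) • (q • x) = q.num • (m • x) := by
      rw [← Nat.cast_smul_eq_nsmul ℚ, ← Nat.cast_smul_eq_nsmul ℚ m, ← Int.cast_smul_eq_zsmul ℚ,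
        smul_smul, smul_smul, ← Rat.den_mul_eq_num]
      congr 1
      push_cast
      ring
    rw [this]
    exact zsmul_mem hx _

/-- The least cut-closed cone that contains a finite set is finitely generated. -/
theorem ConeCutClosed.exists_finset_hull {Λ : AddSubgroup V} (hΛ : Λ.FG) {e : V} (heΛ : e ∈ Λ)
    {B : Finset V} (heB : e ∈ B) {C : PointedCone ℚ V} (hC : ConeCutClosed Λ e C)
    (hB : ∀ b ∈ B, b ∈ C) (hne : -e ∉ C)
    (hmin : ∀ C' : PointedCone ℚ V, ConeCutClosed Λ e C' → (∀ b ∈ B, b ∈ C') → C ≤ C') :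
    ∃ R : Finset V, C = PointedCone.hull ℚ (R : Set V) := by
  classical
  have hfin : Module.Finite ℤ Λ :=
    Module.Finite.iff_addGroup_fg.2 ((AddGroup.fg_iff_addSubgroup_fg Λ).2 hΛ)
  let W := Submodule.span ℚ (Λ : Set V)
  have hΛW : ∀ x ∈ Λ, x ∈ W := fun x hx => Submodule.subset_span hx
  -- Cuts concern only the rational span `W` of `Λ`. The part of the cone over `B` inside `W` is
  -- finitely generated, and its generators are scaled into `Λ` by `γ`.
  obtain ⟨R0, hR0⟩ := exists_finset_preimage_add_hull W.subtype ⊥ B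
  have hR0' : ∀ x : W, (x : V) ∈ PointedCone.hull ℚ (B : Set V) ↔
      x ∈ PointedCone.hull ℚ (R0 : Set W) := by
    intro x
    have := Set.ext_iff.1 hR0 x
    simpa using this
  choose k hk hkΛ using fun r : W => exists_nsmul_mem_of_mem_span Λ r.2
  let γ : W → Λ := fun r => ⟨k r • (r : V), hkΛ r⟩
  let e' : Λ := ⟨e, heΛ⟩
  let G : Finset Λ := insert e' (R0.image γ)
  let K : AddSubmonoid Λ := sInf {K' | IsCutClosed e' K' ∧ ∀ g ∈ G, g ∈ K'}
  have hmemK : ∀ {x}, x ∈ K ↔ ∀ K', IsCutClosed e' K' → (∀ g ∈ G, g ∈ K') → x ∈ K' := by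
    intro x
    simp [K, AddSubmonoid.mem_sInf]
  have hKcut : IsCutClosed e' K := fun x n m hn hx => hmemK.2 fun K' h1 h2 =>
    h1 x n m hn (hmemK.1 hx K' h1 h2)
  have hGK : ∀ g ∈ G, g ∈ K := fun g hg => hmemK.2 fun K' _ h2 => h2 g hg
  have hKmin : ∀ K', IsCutClosed e' K' → (∀ g ∈ G, g ∈ K') → K ≤ K' := fun K' h1 h2 x hx =>
    hmemK.1 hx K' h1 h2
  have hKC : ∀ x ∈ K, (x : V) ∈ C := by
    refine hKmin (C.toAddSubmonoid.comap Λ.subtype) ?_ ?_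
    · intro x n m hn hx
      simpa using hC x x.2 n m hn (by simpa using hx)
    · intro g hg
      rcases Finset.mem_insert.1 hg with rfl | hg
      · exact hB e heB
      · obtain ⟨r, hr, rfl⟩ := Finset.mem_image.1 hg
        have h1 := (hR0' r).2 (PointedCone.subset_hull hr)
        have h2 : (r : V) ∈ C := Submodule.span_le.2 hB h1
        exact nsmul_mem h2 (k r)
  have hneK : -e' ∉ K := fun h => hne (by simpa using hKC _ h)
  -- A single closure step inside `Λ` suffices. If `n • x + m • e = c + d` with `c` in the cone over
  -- `B` and `d` in the cone over `K`, then `c` lies in `W`, hence in the cone over `K`. So a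
  -- positive multiple of the left side lies in `K`, where it can be cut.
  let E : PointedCone ℚ V := PointedCone.hull ℚ ((B : Set V) ∪ Λ.subtype '' (K : Set Λ))
  have hEcut : ConeCutClosed Λ e E := by
    intro x hx n m hn hE
    rw [show E = _ from Submodule.span_union _ _, Submodule.mem_sup] at hE
    obtain ⟨c, hc, d, hd, hcd⟩ := hE
    have hdW : d ∈ W := by
      refine Submodule.span_mono ?_ (PointedCone.hull_le_span ℚ _ hd)
      rintro _ ⟨y, -, rfl⟩
      exact y.2
    have hcW : c ∈ W := by
      rw [eq_sub_of_add_eq hcd]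
      exact sub_mem (hΛW _ (add_mem (nsmul_mem hx _) (zsmul_mem heΛ _))) hdW
    have hR0K : ∀ w : W, w ∈ PointedCone.hull ℚ (R0 : Set W) →
        (w : V) ∈ PointedCone.hull ℚ (Λ.subtype '' (K : Set Λ)) := by
      intro w hw
      have : PointedCone.hull ℚ (R0 : Set W) ≤
          (PointedCone.hull ℚ (Λ.subtype '' (K : Set Λ))).comap W.subtype := by
        refine Submodule.span_le.2 fun r hr => ?_
        refine hull_mem_of_nsmul_mem _ (hk r) (PointedCone.subset_hull ⟨γ r, ?_, rfl⟩)
        exact hGK _ (Finset.mem_insert_of_mem (Finset.mem_image_of_mem _ hr))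
      exact this hw
    have hcK := hR0K ⟨c, hcW⟩ ((hR0' ⟨c, hcW⟩).1 hc)
    have hsum := add_mem hcK hd
    rw [hcd] at hsum
    obtain ⟨N, hN, hNmem⟩ := exists_nsmul_mem_closure hsum
    have h1 : N • (n • (⟨x, hx⟩ : Λ) + m • e') ∈ AddSubmonoid.closure (K : Set Λ) :=
      closure_image_of_injective Λ.subtype Subtype.val_injective _ (by simpa [e'] using hNmem)
    rw [AddSubmonoid.closure_eq] at h1
    have h2 := hKcut ⟨x, hx⟩ (N * n) (N * m) (Nat.mul_pos hN hn) (by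
      convert h1 using 1
      simp only [← natCast_zsmul]
      push_cast
      module)
    rw [Nat.cast_mul, Int.mul_ediv_mul_of_pos _ _ (by exact_mod_cast hN)] at h2
    exact PointedCone.subset_hull (Or.inr ⟨_, h2, by simp [e']⟩)
  obtain ⟨R, hRK, hR⟩ := IsCutClosed.exists_finset_generators Λ.subtype Subtype.val_injective K G
    hKcut (Finset.mem_insert_self _ _) hneK hGK hKmin
  refine ⟨B ∪ R.image Λ.subtype, le_antisymm ?_ ?_⟩
  · refine (hmin E hEcut fun b hb => PointedCone.subset_hull (Or.inl hb)).trans ?_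
    refine Submodule.span_le.2 ?_
    rw [Finset.coe_union, Finset.coe_image]
    rintro _ (hb | ⟨x, hx, rfl⟩)
    · exact PointedCone.subset_hull (Or.inl hb)
    · obtain ⟨n, hn, hcl⟩ := hR x hx
      refine hull_mem_of_nsmul_mem _ hn ?_
      have h1 := AddSubmonoid.mem_map_of_mem Λ.subtype hcl
      rw [AddMonoidHom.map_mclosure, map_nsmul] at h1
      exact hull_mono Set.subset_union_right (closure_subset_hull _ h1)
  · refine Submodule.span_le.2 ?_
    rw [Finset.coe_union, Finset.coe_image]
    rintro _ (hb | ⟨x, hx, rfl⟩)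
    · exact hB _ hb
    · exact hKC _ (hRK x hx)

end CuttingPlanes

/-! ### Regular cones in rings and their ideals of units. -/

section RegularCones

variable {A : Type*} [CommRing A] [Algebra ℚ A]

/-- A cone in a ring that contains `1`, is closed under cutting planes for the integral elements
`Λ`, and whose invertible elements are closed under multiplication by ring elements. -/
structure IsRegularCone (Λ : AddSubgroup A) (C : PointedCone ℚ A) : Prop where
  one_mem : 1 ∈ C
  cut : ConeCutClosed Λ 1 C
  mul_mem : ∀ x, x ∈ C → -x ∈ C → ∀ a, a * x ∈ C

/-- The ideal of invertible elements of a regular cone. -/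
def IsRegularCone.units {Λ : AddSubgroup A} {C : PointedCone ℚ A} (hC : IsRegularCone Λ C) :
    Ideal A where
  carrier := {x | x ∈ C ∧ -x ∈ C}
  zero_mem' := by simp
  add_mem' := by
    rintro x y ⟨h1, h2⟩ ⟨h3, h4⟩
    exact ⟨add_mem h1 h3, by rw [neg_add]; exact add_mem h2 h4⟩
  smul_mem' := by
    rintro a x ⟨h1, h2⟩
    refine ⟨hC.mul_mem x h1 h2 a, ?_⟩
    have := hC.mul_mem x h1 h2 (-a)
    rwa [neg_mul] at this

theorem IsRegularCone.mem_of_sub_mem {Λ : AddSubgroup A} {C : PointedCone ℚ A}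
    (hC : IsRegularCone Λ C) {x y : A} (hy : y ∈ C) (h : x - y ∈ hC.units) : x ∈ C := by
  simpa using add_mem hy h.1

/-- The least regular cone that contains `B`. -/
def leastCone (Λ : AddSubgroup A) (B : Set A) : PointedCone ℚ A :=
  sInf {C | IsRegularCone Λ C ∧ B ⊆ C}

theorem mem_leastCone {Λ : AddSubgroup A} {B : Set A} {x : A} :
    x ∈ leastCone Λ B ↔ ∀ C : PointedCone ℚ A, IsRegularCone Λ C → B ⊆ C → x ∈ C := by
  simp [leastCone, Submodule.mem_sInf]

theorem isRegularCone_leastCone (Λ : AddSubgroup A) (B : Set A) :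
    IsRegularCone Λ (leastCone Λ B) where
  one_mem := mem_leastCone.2 fun _ h _ => h.one_mem
  cut := fun x hx n m hn h => mem_leastCone.2 fun C hC hB =>
    hC.cut x hx n m hn (mem_leastCone.1 h C hC hB)
  mul_mem := fun x h1 h2 a => mem_leastCone.2 fun C hC hB =>
    hC.mul_mem x (mem_leastCone.1 h1 C hC hB) (mem_leastCone.1 h2 C hC hB) a

theorem subset_leastCone (Λ : AddSubgroup A) (B : Set A) : B ⊆ leastCone Λ B :=
  fun _ hx => mem_leastCone.2 fun _ _ hB => hB hx

/-- The least regular cone over a finite set is the sum of an ideal and a finitely generated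
cone. -/
theorem exists_finset_leastCone {Λ : AddSubgroup A} (hΛ : Λ.FG) (h1Λ : 1 ∈ Λ) (B : Finset A)
    (hne : -1 ∉ leastCone Λ (B : Set A)) :
    ∃ R : Finset A, (leastCone Λ (B : Set A) : Set A) =
      ((isRegularCone_leastCone Λ (B : Set A)).units : Set A) +
        (PointedCone.hull ℚ (R : Set A) : Set A) := by
  classical
  set C := leastCone Λ (B : Set A) with hCdef
  have hC : IsRegularCone Λ C := isRegularCone_leastCone Λ (B : Set A)
  let I := hC.units
  let π : A →ₗ[ℚ] A ⧸ I := (Ideal.Quotient.mkₐ ℚ I).toLinearMap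
  have hπ : ∀ x y, π x = π y ↔ x - y ∈ I := fun x y => Ideal.Quotient.eq
  have hπC : ∀ x, π x ∈ C.map π ↔ x ∈ C := by
    intro x
    refine ⟨?_, fun h => ⟨x, h, rfl⟩⟩
    rintro ⟨y, hy, hyx⟩
    exact hC.mem_of_sub_mem hy ((hπ x y).1 hyx.symm)
  have hπcut : ∀ (x : A) (n : ℕ) (m : ℤ), n • π x + m • π 1 = π (n • x + m • 1) := by
    intro x n m
    rw [map_add, map_nsmul, map_zsmul]
  have hπcut' : ∀ (x : A) (m : ℤ), π x + m • π 1 = π (x + m • 1) := by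
    intro x m
    rw [map_add, map_zsmul]
  have hΛ' : (Λ.map π.toAddMonoidHom).FG := by
    obtain ⟨S, hS⟩ := hΛ
    exact ⟨S.image π, by rw [← hS, AddMonoidHom.map_closure, Finset.coe_image]; rfl⟩
  obtain ⟨R, hR⟩ := ConeCutClosed.exists_finset_hull (Λ := Λ.map π.toAddMonoidHom) (e := π 1)
    (B := (insert 1 B).image π) (C := C.map π) hΛ' ⟨1, h1Λ, rfl⟩
    (Finset.mem_image_of_mem _ (Finset.mem_insert_self _ _))
    (by
      rintro _ ⟨x, hx, rfl⟩ n m hn h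
      change n • π x + m • π 1 ∈ _ at h
      change π x + _ • π 1 ∈ _
      rw [hπcut, hπC] at h
      rw [hπcut', hπC]
      exact hC.cut x hx n m hn h)
    (by
      intro b hb
      obtain ⟨x, hx, rfl⟩ := Finset.mem_image.1 hb
      rw [hπC]
      rcases Finset.mem_insert.1 hx with rfl | hx
      · exact hC.one_mem
      · exact subset_leastCone Λ _ hx)
    (by rwa [← map_neg, hπC])
    (by
      intro C' hcut hB
      -- The ideal condition disappears in the quotient: units of the intersection are units of `C`,
      -- so they and their multiples map to zero. Minimality of `C` therefore transfers to its image
      -- among cut-closed cones.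
      have hD : IsRegularCone Λ (C'.comap π ⊓ C) :=
        { one_mem := ⟨hB _ (Finset.mem_image_of_mem _ (Finset.mem_insert_self _ _)), hC.one_mem⟩
          cut := by
            rintro x hx n m hn ⟨h1, h2⟩
            refine ⟨?_, hC.cut x hx n m hn h2⟩
            have := hcut (π x) ⟨x, hx, rfl⟩ n m hn (by rw [hπcut]; exact h1)
            rwa [hπcut'] at this
          mul_mem := by
            rintro x ⟨-, h2⟩ ⟨-, h4⟩ a
            refine ⟨?_, hC.mul_mem x h2 h4 a⟩
            have : π (a * x) = π 0 := (hπ _ _).2 (by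
              rw [sub_zero]
              exact I.mul_mem_left a ⟨h2, h4⟩)
            change π (a * x) ∈ C'
            rw [this, map_zero]
            exact zero_mem _ }
      rintro _ ⟨x, hx, rfl⟩
      exact (mem_leastCone.1 hx _ hD fun b hb =>
        ⟨hB _ (Finset.mem_image_of_mem _ (Finset.mem_insert_of_mem hb)),
          subset_leastCone Λ _ hb⟩).1)
  choose σ hσ using fun q : A ⧸ I => Ideal.Quotient.mk_surjective q
  have hσ' : ∀ q, π (σ q) = q := hσ
  have hmap : PointedCone.hull ℚ (R : Set (A ⧸ I)) =
      (PointedCone.hull ℚ ((R.image σ : Finset A) : Set A)).map π := by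
    have h := Submodule.map_span (π : A →ₗ[{c : ℚ // 0 ≤ c}] A ⧸ I) ((R.image σ : Finset A) : Set A)
    refine Eq.trans ?_ h.symm
    congr 1
    ext q
    simp only [Finset.coe_image, Set.mem_image, Finset.mem_coe]
    constructor
    · intro hq
      exact ⟨σ q, ⟨q, hq, rfl⟩, hσ' q⟩
    · rintro ⟨_, ⟨q', hq', rfl⟩, rfl⟩
      change π (σ q') ∈ R
      rwa [hσ']
  refine ⟨R.image σ, ?_⟩
  ext x
  simp only [Set.mem_add, SetLike.mem_coe]
  rw [← hπC, hR, hmap]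
  constructor
  · rintro ⟨y, hy, hyx⟩
    exact ⟨x - y, (hπ x y).1 hyx.symm, y, hy, sub_add_cancel _ _⟩
  · rintro ⟨u, hu, y, hy, rfl⟩
    exact ⟨y, hy, (hπ _ _).2 (by rw [sub_add_cancel_right]; exact neg_mem hu)⟩

end RegularCones

/-! ### Models of the theory as rational algebras with a positive cone and a group of integers. -/

section Models

open FirstOrder FirstOrder.Language

section Operations

variable {M : Type*} [sig.Structure M]

/-- The interpretation of `0`. -/
def mZero : M := Structure.funMap (L := sig) Func.zero ![]

/-- The interpretation of `1`. -/
def mOne : M := Structure.funMap (L := sig) Func.one ![]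

/-- The interpretation of `+`. -/
def mAdd (x y : M) : M := Structure.funMap (L := sig) Func.add ![x, y]

/-- The interpretation of `·`. -/
def mMul (x y : M) : M := Structure.funMap (L := sig) Func.mul ![x, y]

/-- The interpretation of `≤`. -/
def mLe (x y : M) : Prop := Structure.RelMap (L := sig) Rel.le ![x, y]

/-- The interpretation of `Int`. -/
def mInt (x : M) : Prop := Structure.RelMap (L := sig) Rel.int ![x]

/-- The interpretation of `tNsmul`. -/
def mNsmul : ℕ → M → M
  | 0, _ => mZero
  | n + 1, x => mAdd (mNsmul n x) x

variable {α : Type*} (v : α → M)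

@[simp] theorem realize_tZero : (tZero : sig.Term α).realize v = (mZero : M) := by
  simp [tZero, Constants.term, mZero, Matrix.empty_eq]

@[simp] theorem realize_tOne : (tOne : sig.Term α).realize v = (mOne : M) := by
  simp [tOne, Constants.term, mOne, Matrix.empty_eq]

@[simp] theorem realize_tAdd (s t : sig.Term α) :
    (tAdd s t).realize v = mAdd (s.realize v) (t.realize v) := by
  simp [tAdd, mAdd]

@[simp] theorem realize_tMul (s t : sig.Term α) :
    (tMul s t).realize v = mMul (s.realize v) (t.realize v) := by
  simp [tMul, mMul]

@[simp] theorem realize_tNsmul (n : ℕ) (t : sig.Term α) :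
    (tNsmul n t).realize v = mNsmul n (t.realize v) := by
  induction n with
  | zero => simp [tNsmul, mNsmul]
  | succ n ih => simp [tNsmul, mNsmul, ih]

@[simp] theorem realize_fLe {n : ℕ} (xs : Fin n → M) (s t : sig.Term (α ⊕ Fin n)) :
    (fLe s t).Realize v xs ↔
      mLe (s.realize (Sum.elim v xs)) (t.realize (Sum.elim v xs)) := by
  simp [fLe, mLe]

@[simp] theorem realize_fInt {n : ℕ} (xs : Fin n → M) (t : sig.Term (α ⊕ Fin n)) :
    (fInt t).Realize v xs ↔ mInt (t.realize (Sum.elim v xs)) := by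
  simp [fInt, mInt]

end Operations

/-- The axioms of linear integer/real rings, spelled out in a structure. -/
structure IsModel (M : Type*) [sig.Structure M] : Prop where
  add_assoc : ∀ x y z : M, mAdd x (mAdd y z) = mAdd (mAdd x y) z
  mul_assoc : ∀ x y z : M, mMul x (mMul y z) = mMul (mMul x y) z
  add_comm : ∀ x y : M, mAdd x y = mAdd y x
  mul_comm : ∀ x y : M, mMul x y = mMul y x
  add_zero : ∀ x : M, mAdd x mZero = x
  mul_one : ∀ x : M, mMul x mOne = x
  mul_add : ∀ x y z : M, mMul x (mAdd y z) = mAdd (mMul x y) (mMul x z)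
  exists_neg : ∀ x : M, ∃ y, mAdd x y = mZero
  le_refl : ∀ x : M, mLe x x
  le_trans : ∀ x y z : M, mLe x y → mLe y z → mLe x z
  le_antisymm : ∀ x y : M, mLe x y → mLe y x → x = y
  add_le_add : ∀ x y z : M, mLe x y → mLe (mAdd x z) (mAdd y z)
  zero_le_one : mLe (mZero : M) mOne
  zero_ne_one : (mZero : M) ≠ mOne
  exists_div : ∀ n : ℕ, 1 ≤ n → ∃ x : M, mNsmul n x = mOne
  perf : ∀ n : ℕ, 1 ≤ n → ∀ x : M, mLe mZero (mNsmul n x) → mLe mZero x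
  int_one : mInt (mOne : M)
  int_add : ∀ x y : M, mInt x → mInt y → mInt (mAdd x y)
  int_neg : ∀ x y : M, mInt x → mAdd x y = mZero → mInt y
  cut : ∀ (n : ℕ) (m : ℤ), 1 ≤ n → ∀ x : M, mInt x →
    mLe (mNsmul (-m).toNat mOne) (mAdd (mNsmul n x) (mNsmul m.toNat mOne)) →
    mLe (mNsmul (-⌊(m : ℚ) / (n : ℚ)⌋).toNat mOne)
      (mAdd x (mNsmul ⌊(m : ℚ) / (n : ℚ)⌋.toNat mOne))

theorem model_ringAxioms {M : Type*} [sig.Structure M] : M ⊨ ringAxioms ↔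
    (∀ x y z : M, mAdd x (mAdd y z) = mAdd (mAdd x y) z) ∧
    (∀ x y z : M, mMul x (mMul y z) = mMul (mMul x y) z) ∧
    (∀ x y : M, mAdd x y = mAdd y x) ∧ (∀ x y : M, mMul x y = mMul y x) ∧
    (∀ x : M, mAdd x mZero = x) ∧ (∀ x : M, mMul x mOne = x) ∧
    (∀ x y z : M, mMul x (mAdd y z) = mAdd (mMul x y) (mMul x z)) ∧
    (∀ x : M, ∃ y, mAdd x y = mZero) := by
  simp [Theory.model_iff, ringAxioms, Sentence.Realize, Formula.Realize, Fin.snoc]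

theorem model_orderAxioms {M : Type*} [sig.Structure M] : M ⊨ orderAxioms ↔
    (∀ x : M, mLe x x) ∧ (∀ x y z : M, mLe x y → mLe y z → mLe x z) ∧
    (∀ x y : M, mLe x y → mLe y x → x = y) ∧
    (∀ x y z : M, mLe x y → mLe (mAdd x z) (mAdd y z)) ∧
    mLe (mZero : M) mOne ∧ (mZero : M) ≠ mOne := by
  simp [Theory.model_iff, orderAxioms, Sentence.Realize, Formula.Realize, Fin.snoc]

theorem model_intAxioms {M : Type*} [sig.Structure M] : M ⊨ intAxioms ↔
    mInt (mOne : M) ∧ (∀ x y : M, mInt x → mInt y → mInt (mAdd x y)) ∧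
    (∀ x y : M, mInt x → mAdd x y = mZero → mInt y) := by
  simp [Theory.model_iff, intAxioms, Sentence.Realize, Formula.Realize, Fin.snoc]

theorem realize_divisibility {M : Type*} [sig.Structure M] (n : ℕ) :
    M ⊨ divisibility n ↔ ∃ x : M, mNsmul n x = mOne := by
  simp [divisibility, Sentence.Realize, Formula.Realize, Fin.snoc]

theorem realize_perforationFree {M : Type*} [sig.Structure M] (n : ℕ) :
    M ⊨ perforationFree n ↔ ∀ x : M, mLe mZero (mNsmul n x) → mLe mZero x := by
  simp [perforationFree, Sentence.Realize, Formula.Realize, Fin.snoc]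

theorem realize_cuttingPlane {M : Type*} [sig.Structure M] (n : ℕ) (m : ℤ) :
    M ⊨ cuttingPlane n m ↔ ∀ x : M, mInt x →
      mLe (mNsmul (-m).toNat mOne) (mAdd (mNsmul n x) (mNsmul m.toNat mOne)) →
      mLe (mNsmul (-⌊(m : ℚ) / (n : ℚ)⌋).toNat mOne)
        (mAdd x (mNsmul ⌊(m : ℚ) / (n : ℚ)⌋.toNat mOne)) := by
  simp [cuttingPlane, Sentence.Realize, Formula.Realize, Fin.snoc, fNonnegAdd, tNat]

theorem model_LIRR {M : Type*} [sig.Structure M] : M ⊨ LIRR ↔ IsModel M := by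
  have h : M ⊨ LIRR ↔ (((M ⊨ ringAxioms ∧ M ⊨ orderAxioms) ∧
      (∀ n : ℕ, 1 ≤ n → M ⊨ divisibility n)) ∧ (∀ n : ℕ, 1 ≤ n → M ⊨ perforationFree n)) ∧
      M ⊨ intAxioms ∧ ∀ (n : ℕ) (m : ℤ), 1 ≤ n → M ⊨ cuttingPlane n m := by
    rw [LIRR, LRR]
    simp only [Theory.model_union_iff, _root_.and_assoc]
    simp only [Theory.model_iff {φ | ∃ n : ℕ, 1 ≤ n ∧ φ = divisibility n},
      Theory.model_iff {φ | ∃ n : ℕ, 1 ≤ n ∧ φ = perforationFree n},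
      Theory.model_iff {φ | ∃ (n : ℕ) (m : ℤ), 1 ≤ n ∧ φ = cuttingPlane n m}]
    refine and_congr Iff.rfl (and_congr Iff.rfl (and_congr ?_ (and_congr ?_
      (and_congr Iff.rfl ?_))))
    · exact ⟨fun h n hn => h _ ⟨n, hn, rfl⟩, by rintro h _ ⟨n, hn, rfl⟩; exact h n hn⟩
    · exact ⟨fun h n hn => h _ ⟨n, hn, rfl⟩, by rintro h _ ⟨n, hn, rfl⟩; exact h n hn⟩
    · exact ⟨fun h n m hn => h _ ⟨n, m, hn, rfl⟩, by rintro h _ ⟨n, m, hn, rfl⟩; exact h n m hn⟩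
  rw [h, model_ringAxioms, model_orderAxioms, model_intAxioms]
  simp only [realize_divisibility, realize_perforationFree, realize_cuttingPlane]
  constructor
  · rintro ⟨⟨⟨⟨⟨a1, a2, a3, a4, a5, a6, a7, a8⟩, b1, b2, b3, b4, b5, b6⟩, c⟩, d⟩, ⟨e1, e2, e3⟩, f⟩
    exact ⟨a1, a2, a3, a4, a5, a6, a7, a8, b1, b2, b3, b4, b5, b6, c, d, e1, e2, e3, f⟩
  · rintro ⟨a1, a2, a3, a4, a5, a6, a7, a8, b1, b2, b3, b4, b5, b6, c, d, e1, e2, e3, f⟩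
    exact ⟨⟨⟨⟨⟨a1, a2, a3, a4, a5, a6, a7, a8⟩, b1, b2, b3, b4, b5, b6⟩, c⟩, d⟩, ⟨e1, e2, e3⟩, f⟩

/-- A positive cone and a group of integers on a rational algebra that make it a linear
integer/real ring. -/
structure IntRealRing (A : Type*) [CommRing A] [Algebra ℚ A] where
  pos : PointedCone ℚ A
  int : AddSubgroup A
  one_mem_pos : 1 ∈ pos
  eq_zero : ∀ x, x ∈ pos → -x ∈ pos → x = 0
  one_mem_int : 1 ∈ int
  cut : ConeCutClosed int 1 pos

namespace IntRealRing

section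

variable {A : Type*} [CommRing A] [Algebra ℚ A] (S : IntRealRing A)

/-- The structure on a linear integer/real ring. -/
@[reducible] def toStructure : sig.Structure A where
  funMap {n} f := match n, f with
    | _, Func.zero => fun _ => 0
    | _, Func.one => fun _ => 1
    | _, Func.add => fun x => x 0 + x 1
    | _, Func.mul => fun x => x 0 * x 1
  RelMap {n} r := match n, r with
    | _, Rel.le => fun x => x 1 - x 0 ∈ S.pos
    | _, Rel.int => fun x => x 0 ∈ S.int

theorem toStructure_mZero : @mZero A S.toStructure = 0 := rfl
theorem toStructure_mOne : @mOne A S.toStructure = 1 := rfl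
theorem toStructure_mAdd (x y : A) : @mAdd A S.toStructure x y = x + y := rfl
theorem toStructure_mMul (x y : A) : @mMul A S.toStructure x y = x * y := rfl
theorem toStructure_mLe (x y : A) : @mLe A S.toStructure x y ↔ y - x ∈ S.pos := Iff.rfl
theorem toStructure_mInt (x : A) : @mInt A S.toStructure x ↔ x ∈ S.int := Iff.rfl
theorem toStructure_mNsmul (n : ℕ) (x : A) : @mNsmul A S.toStructure n x = n • x := by
  induction n with
  | zero => simp [mNsmul, toStructure_mZero]
  | succ n ih =>
    change @mAdd A S.toStructure (@mNsmul A S.toStructure n x) x = _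
    rw [ih, toStructure_mAdd, succ_nsmul]

theorem isModel [Nontrivial A] : @IsModel A S.toStructure := by
  -- At most one of `k.toNat` and `(-k).toNat` is nonzero, so this undoes the moving of negative
  -- constants to the left side of an atom.
  have hcast : ∀ (x : A) (k : ℤ),
      x + k.toNat • (1 : A) - (-k).toNat • (1 : A) = x + k • (1 : A) := by
    intro x k
    rw [add_sub_assoc, ← natCast_zsmul, ← natCast_zsmul, ← sub_smul]
    congr 2
    omega
  let _ := S.toStructure
  constructor <;>
    simp only [toStructure_mZero, toStructure_mOne, toStructure_mAdd, toStructure_mMul,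
      toStructure_mLe, toStructure_mInt, toStructure_mNsmul, sub_zero]
  · intros; ring
  · intros; ring
  · intros; ring
  · intros; ring
  · intros; ring
  · intros; ring
  · intros; ring
  · exact fun x => ⟨-x, by ring⟩
  · exact fun x => by simp
  · intro x y z h1 h2
    simpa using add_mem h1 h2
  · intro x y h1 h2
    exact (sub_eq_zero.1 (S.eq_zero _ h1 (by simpa using h2))).symm
  · intro x y z h
    simpa using h
  · exact S.one_mem_pos
  · exact zero_ne_one
  · intro n hn
    refine ⟨algebraMap ℚ A (n : ℚ)⁻¹, ?_⟩
    have hn' : (n : ℚ) ≠ 0 := by positivity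
    rw [← map_nsmul, nsmul_eq_mul, mul_inv_cancel₀ hn', map_one]
  · intro n hn x h
    exact hull_mem_of_nsmul_mem _ hn h
  · exact S.one_mem_int
  · exact fun x y hx hy => add_mem hx hy
  · intro x y hx hxy
    rw [eq_neg_of_add_eq_zero_right hxy]
    exact neg_mem hx
  · intro n m hn x hx h
    rw [hcast] at h
    rw [hcast, Rat.floor_intCast_div_natCast]
    exact S.cut x hx n m hn h

end

/-- Every model of the theory is a linear integer/real ring. -/
theorem exists_of_isModel {M : Type*} [inst : sig.Structure M] (h : IsModel M) :
    ∃ (_ : CommRing M) (_ : Algebra ℚ M) (S : IntRealRing M),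
      Nontrivial M ∧ inst = S.toStructure := by
  choose neg hneg using h.exists_neg
  let R : CommRing M :=
    { add := mAdd
      mul := mMul
      zero := mZero
      one := mOne
      neg := neg
      add_assoc := fun x y z => (h.add_assoc x y z).symm
      mul_assoc := fun x y z => (h.mul_assoc x y z).symm
      add_comm := h.add_comm
      mul_comm := h.mul_comm
      add_zero := h.add_zero
      zero_add := fun x => (h.add_comm _ _).trans (h.add_zero x)
      mul_one := h.mul_one
      one_mul := fun x => (h.mul_comm _ _).trans (h.mul_one x)
      left_distrib := h.mul_add
      right_distrib := fun x y z => by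
        change mMul (mAdd x y) z = mAdd (mMul x z) (mMul y z)
        rw [h.mul_comm, h.mul_add, h.mul_comm z x, h.mul_comm z y]
      zero_mul := fun x => by
        change mMul mZero x = mZero
        have h1 : mAdd (mMul x mZero) (mMul x mZero) = mMul x mZero := by
          rw [← h.mul_add, h.add_zero]
        have h2 := congrArg (fun y => mAdd y (neg (mMul x mZero))) h1
        simp only [← h.add_assoc, hneg, h.add_zero] at h2
        rw [h.mul_comm, h2]
      mul_zero := fun x => by
        change mMul x mZero = mZero
        have h1 : mAdd (mMul x mZero) (mMul x mZero) = mMul x mZero := by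
          rw [← h.mul_add, h.add_zero]
        have h2 := congrArg (fun y => mAdd y (neg (mMul x mZero))) h1
        simpa only [← h.add_assoc, hneg, h.add_zero] using h2
      neg_add_cancel := fun x => (h.add_comm _ _).trans (hneg x)
      nsmul := @nsmulRec M ⟨mZero⟩ ⟨mAdd⟩
      zsmul := @zsmulRec M ⟨mZero⟩ ⟨mAdd⟩ ⟨neg⟩ (@nsmulRec M ⟨mZero⟩ ⟨mAdd⟩) }
  have hadd : ∀ x y : M, mAdd x y = x + y := fun _ _ => rfl
  have hzero : (mZero : M) = 0 := rfl
  have hone : (mOne : M) = 1 := rfl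
  have hnsmul : ∀ (n : ℕ) (x : M), mNsmul n x = n • x := by
    intro n x
    induction n with
    | zero => simp [mNsmul, hzero]
    | succ n ih => rw [mNsmul, hadd, ih, succ_nsmul]
  have hle : ∀ x y : M, mLe x y ↔ mLe 0 (y - x) := by
    intro x y
    constructor
    · intro hxy
      have := h.add_le_add x y (-x) hxy
      rwa [hadd, hadd, add_neg_cancel, ← sub_eq_add_neg] at this
    · intro hxy
      have := h.add_le_add _ _ x hxy
      rwa [hadd, hadd, zero_add, sub_add_cancel] at this
  have hnontriv : Nontrivial M := ⟨⟨0, 1, h.zero_ne_one⟩⟩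
  have hunit : ∀ n : ℕ, 1 ≤ n → IsUnit (n : M) := by
    intro n hn
    obtain ⟨x, hx⟩ := h.exists_div n hn
    rw [hnsmul, nsmul_eq_mul] at hx
    exact IsUnit.of_mul_eq_one x hx
  have hunit' : ∀ z : ℤ, z ≠ 0 → IsUnit (z : M) := by
    intro z hz0
    have := hunit z.natAbs (Nat.pos_of_ne_zero (by simpa using hz0))
    rcases Int.natAbs_eq z with hz | hz
    · rw [hz]
      simpa using this
    · rw [hz]
      simpa using this.neg
  -- Divisibility makes all nonzero integers invertible in `M`, so the map from the integers extends
  -- to the rationals.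
  let alg : Algebra ℚ M := (IsLocalization.lift (M := nonZeroDivisors ℤ) (S := ℚ)
    (g := Int.castRingHom M)
    fun z => hunit' z (nonZeroDivisors.coe_ne_zero z)).toAlgebra
  let S : IntRealRing M :=
    { pos :=
        { carrier := {x | mLe 0 x}
          zero_mem' := h.le_refl _
          add_mem' := by
            intro x y hx hy
            have := h.add_le_add _ _ x hy
            rw [hadd, hadd, zero_add, add_comm] at this
            exact h.le_trans _ _ _ hx this
          smul_mem' := by
            rintro ⟨q, hq⟩ x hx
            have hnat : ∀ n : ℕ, mLe 0 (n • x) := by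
              intro n
              induction n with
              | zero => simpa using h.le_refl _
              | succ n ih =>
                rw [succ_nsmul]
                have := h.add_le_add _ _ x ih
                rw [hadd, hadd, zero_add] at this
                exact h.le_trans _ _ _ hx this
            change mLe 0 (q • x)
            -- Perforation-freeness makes the positive cone closed under nonnegative rational
            -- scalars: after multiplying by the denominator only a natural multiple of `x` remains.
            apply h.perf q.den q.pos
            rw [hnsmul, hzero]
            have h1 : q.den • q • x = q.num.toNat • x := by
              rw [← Nat.cast_smul_eq_nsmul ℚ, ← Nat.cast_smul_eq_nsmul ℚ, smul_smul,
                Rat.den_mul_eq_num]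
              congr 1
              exact_mod_cast (Int.toNat_of_nonneg (Rat.num_nonneg.2 hq)).symm
            rw [h1]
            exact hnat _ }
      int :=
        { carrier := {x | mInt x}
          zero_mem' := by
            have h1 : mInt (-1 : M) := h.int_neg 1 (-1) h.int_one (add_neg_cancel 1)
            have := h.int_add _ _ h.int_one h1
            rwa [hadd, hone, add_neg_cancel] at this
          add_mem' := fun {x y} hx hy => h.int_add x y hx hy
          neg_mem' := fun {x} hx => h.int_neg x (-x) hx (add_neg_cancel x) }
      one_mem_pos := h.zero_le_one
      eq_zero := by
        intro x h1 h2
        exact (h.le_antisymm 0 x h1 ((hle x 0).2 (by rw [zero_sub]; exact h2))).symm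
      one_mem_int := h.int_one
      cut := by
        have hcast : ∀ (x : M) (k : ℤ),
            x + k.toNat • (1 : M) - (-k).toNat • (1 : M) = x + k • (1 : M) := by
          intro x k
          rw [add_sub_assoc, ← natCast_zsmul, ← natCast_zsmul, ← sub_smul]
          congr 2
          omega
        intro x hx n m hn hc
        have := h.cut n m hn x hx
        rw [hle, hle (mNsmul _ _)] at this
        simp only [hadd, hnsmul, hone, hcast, Rat.floor_intCast_div_natCast] at this
        exact this hc }
  refine ⟨R, alg, S, hnontriv, ?_⟩
  apply Structure.ext
  · funext n f x
    cases f
    · exact congrArg (Structure.funMap (L := sig) Func.zero) (Subsingleton.elim x ![])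
    · exact congrArg (Structure.funMap (L := sig) Func.one) (Subsingleton.elim x ![])
    · refine congrArg (Structure.funMap (L := sig) Func.add) (?_ : x = ![x 0, x 1])
      ext i; fin_cases i <;> rfl
    · refine congrArg (Structure.funMap (L := sig) Func.mul) (?_ : x = ![x 0, x 1])
      ext i; fin_cases i <;> rfl
  · funext n r x
    cases r
    · have hx : x = ![x 0, x 1] := by ext i; fin_cases i <;> rfl
      rw [hx]
      exact propext (hle (x 0) (x 1))
    · have hx : x = ![x 0] := by ext i; fin_cases i; rfl
      rw [hx]
      rfl

section Realization

variable {A : Type*} [CommRing A] [Algebra ℚ A] (S : IntRealRing A)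

/-- Satisfaction of a formula in a linear integer/real ring. -/
def Holds {α : Type*} {n : ℕ} (φ : sig.BoundedFormula α n) (v : α → A) (xs : Fin n → A) : Prop :=
  @BoundedFormula.Realize sig A S.toStructure α n φ v xs

/-- The value of a term in a linear integer/real ring. -/
def eval {α : Type*} (t : sig.Term α) (v : α → A) : A := @Term.realize sig A S.toStructure α v t

variable {α : Type*}

@[simp] theorem eval_var (i : α) (v : α → A) : S.eval (Term.var i) v = v i := rfl

@[simp] theorem eval_tZero (v : α → A) : S.eval tZero v = 0 :=
  letI := S.toStructure; realize_tZero v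

@[simp] theorem eval_tOne (v : α → A) : S.eval tOne v = 1 :=
  letI := S.toStructure; realize_tOne v

@[simp] theorem eval_tAdd (s t : sig.Term α) (v : α → A) :
    S.eval (tAdd s t) v = S.eval s v + S.eval t v :=
  letI := S.toStructure; realize_tAdd v s t

@[simp] theorem eval_tMul (s t : sig.Term α) (v : α → A) :
    S.eval (tMul s t) v = S.eval s v * S.eval t v :=
  letI := S.toStructure; realize_tMul v s t

@[simp] theorem eval_tNsmul (n : ℕ) (t : sig.Term α) (v : α → A) :
    S.eval (tNsmul n t) v = n • S.eval t v :=
  letI := S.toStructure; (realize_tNsmul v n t).trans (S.toStructure_mNsmul n _)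

@[simp] theorem eval_tPow (n : ℕ) (t : sig.Term α) (v : α → A) :
    S.eval (tPow n t) v = S.eval t v ^ n := by
  induction n with
  | zero => simp [tPow]
  | succ n ih => simp [tPow, ih, pow_succ]

theorem eval_foldr_tMul (l : List (sig.Term α)) (v : α → A) :
    S.eval (l.foldr tMul tOne) v = (l.map fun t => S.eval t v).prod := by
  induction l with
  | nil => simp
  | cons t l ih => simp [ih]

theorem eval_foldr_tAdd (l : List (sig.Term α)) (v : α → A) :
    S.eval (l.foldr tAdd tZero) v = (l.map fun t => S.eval t v).sum := by
  induction l with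
  | nil => simp
  | cons t l ih => simp [ih]

theorem eval_tMonomial (m : α →₀ ℕ) (v : α → A) :
    S.eval (tMonomial m) v = m.prod fun i k => v i ^ k := by
  rw [tMonomial, eval_foldr_tMul, List.map_map, Finsupp.prod, Finset.prod_eq_multiset_prod,
    ← Finset.coe_toList, Multiset.map_coe, Multiset.prod_coe]
  congr 1
  refine List.map_congr_left fun i _ => ?_
  simp

/-- This makes the translation of rational atoms faithful: the factor `commonDen p` is positive and
can be cancelled in both kinds of atom. -/
theorem eval_tPos_sub_tNeg (p : MvPolynomial α ℚ) (v : α → A) :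
    S.eval (tPos p) v - S.eval (tNeg p) v = commonDen p • MvPolynomial.aeval v p := by
  have h1 : S.eval (tPos p) v = ∑ m ∈ p.support,
      ((commonDen p : ℚ) * p.coeff m).num.toNat • m.prod fun i k => v i ^ k := by
    rw [tPos, eval_foldr_tAdd, List.map_map, Finset.sum_eq_multiset_sum, ← Finset.coe_toList,
      Multiset.map_coe, Multiset.sum_coe]
    congr 1
    refine List.map_congr_left fun i _ => ?_
    simp [eval_tMonomial]
  have h2 : S.eval (tNeg p) v = ∑ m ∈ p.support,
      (-((commonDen p : ℚ) * p.coeff m)).num.toNat • m.prod fun i k => v i ^ k := by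
    rw [tNeg, eval_foldr_tAdd, List.map_map, Finset.sum_eq_multiset_sum, ← Finset.coe_toList,
      Multiset.map_coe, Multiset.sum_coe]
    congr 1
    refine List.map_congr_left fun i _ => ?_
    simp [eval_tMonomial]
  rw [h1, h2, ← Finset.sum_sub_distrib, MvPolynomial.aeval_def, MvPolynomial.eval₂_eq,
    Finset.smul_sum]
  refine Finset.sum_congr rfl fun m hm => ?_
  have hint : ((commonDen p : ℚ) * p.coeff m) = ((commonDen p : ℚ) * p.coeff m).num := by
    obtain ⟨k, hk⟩ := Finset.dvd_prod_of_mem (fun m => (p.coeff m).den) hm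
    have : (commonDen p : ℚ) * p.coeff m = ((k * (p.coeff m).num : ℤ) : ℚ) := by
      rw [show (commonDen p : ℚ) = (p.coeff m).den * k by exact_mod_cast hk, mul_right_comm,
        Rat.den_mul_eq_num]
      push_cast
      ring
    rw [this, Rat.num_intCast]
  set z := ((commonDen p : ℚ) * p.coeff m).num with hz
  have h3 : (-((commonDen p : ℚ) * p.coeff m)).num = -z := by rw [Rat.num_neg_eq_neg_num]
  rw [h3, ← natCast_zsmul, ← natCast_zsmul, ← sub_smul]
  have h4 : ((z.toNat : ℤ) - ((-z).toNat : ℤ)) = z := by omega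
  rw [h4, ← Algebra.smul_def, ← Nat.cast_smul_eq_nsmul ℚ, smul_smul, hint, Int.cast_smul_eq_zsmul]
  rfl

theorem commonDen_pos (p : MvPolynomial α ℚ) : 1 ≤ commonDen p :=
  Finset.prod_pos fun m _ => (p.coeff m).pos

@[simp] theorem holds_fNonneg {n : ℕ} (p : MvPolynomial (α ⊕ Fin n) ℚ) (v : α → A)
    (xs : Fin n → A) :
    S.Holds (fNonneg p) v xs ↔ MvPolynomial.aeval (Sum.elim v xs) p ∈ S.pos := by
  let _ := S.toStructure
  refine (realize_fLe v xs _ _).trans ?_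
  rw [toStructure_mLe]
  change S.eval (tPos p) _ - S.eval (tNeg p) _ ∈ _ ↔ _
  rw [eval_tPos_sub_tNeg]
  exact ⟨hull_mem_of_nsmul_mem _ (commonDen_pos p), fun h => nsmul_mem h _⟩

@[simp] theorem holds_fZero {n : ℕ} (p : MvPolynomial (α ⊕ Fin n) ℚ) (v : α → A)
    (xs : Fin n → A) :
    S.Holds (fZero p) v xs ↔ MvPolynomial.aeval (Sum.elim v xs) p = 0 := by
  let _ := S.toStructure
  refine (BoundedFormula.realize_bdEqual _ _).trans ?_
  change S.eval (tNeg p) _ = S.eval (tPos p) _ ↔ _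
  rw [eq_comm, ← sub_eq_zero, eval_tPos_sub_tNeg, ← Nat.cast_smul_eq_nsmul ℚ, smul_eq_zero]
  have := commonDen_pos p
  have h0 : (commonDen p : ℚ) ≠ 0 := by positivity
  simp [h0]

end Realization

end IntRealRing

/-- Entailment is entailment in linear integer/real rings. -/
theorem imp_iff {α : Type u} {n : ℕ} (φ ψ : sig.BoundedFormula α n) :
    (φ ⟹[LIRR] ψ) ↔ ∀ (A : Type u) [CommRing A] [Algebra ℚ A] [Nontrivial A] (S : IntRealRing A)
      (v : α → A) (xs : Fin n → A), S.Holds φ v xs → S.Holds ψ v xs := by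
  constructor
  · intro h A _ _ _ S v xs
    let _ := S.toStructure
    have : A ⊨ LIRR := model_LIRR.2 S.isModel
    exact h (Theory.ModelType.of LIRR A) v xs
  · intro h M v xs
    obtain ⟨_, _, S, _, hS⟩ := IntRealRing.exists_of_isModel (model_LIRR.1 M.is_model)
    have := h M S v xs
    rw [IntRealRing.Holds, IntRealRing.Holds, ← hS] at this
    exact this

end Models

/-! ### Closure of algebraic cones under preimages and intersections. -/

section AlgebraicCones

variable {β γ : Type*}

/-- A set of polynomials is an algebraic cone if it is the sum of a finitely generated ideal and a
finitely generated convex cone. -/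
def IsAlgCone (C : Set (MvPolynomial β ℚ)) : Prop :=
  ∃ Z P : Finset (MvPolynomial β ℚ), algCone Z P = C

theorem isAlgCone_add [Finite β] (I : Ideal (MvPolynomial β ℚ)) (P : Finset (MvPolynomial β ℚ)) :
    IsAlgCone ((I : Set (MvPolynomial β ℚ)) +
      (PointedCone.hull ℚ (P : Set (MvPolynomial β ℚ)) : Set (MvPolynomial β ℚ))) := by
  obtain ⟨Z, hZ⟩ := (isNoetherianRing_iff_ideal_fg _).1 inferInstance I
  exact ⟨Z, P, by rw [algCone, ← hZ]⟩

/-- Needed for inconsistent formulas, which entail every atom. -/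
theorem isAlgCone_univ : IsAlgCone (Set.univ : Set (MvPolynomial β ℚ)) := by
  refine ⟨{1}, ∅, ?_⟩
  simp [algCone, Ideal.span_singleton_one]

/-- The preimage of the ideal is again an ideal, finitely generated by Hilbert's basis theorem; the
remaining cone is handled by rational linear algebra. -/
theorem IsAlgCone.preimage [Finite β] {C : Set (MvPolynomial γ ℚ)} (hC : IsAlgCone C)
    (f : MvPolynomial β ℚ →ₐ[ℚ] MvPolynomial γ ℚ) : IsAlgCone (f ⁻¹' C) := by
  obtain ⟨Z, P, rfl⟩ := hC
  obtain ⟨R, hR⟩ := exists_finset_preimage_add_hull f.toLinearMap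
    ((Ideal.span (Z : Set (MvPolynomial γ ℚ))).restrictScalars ℚ) P
  have := isAlgCone_add ((Ideal.span (Z : Set (MvPolynomial γ ℚ))).comap f) R
  convert this using 1
  exact hR

theorem IsAlgCone.inter [Finite β] {C D : Set (MvPolynomial β ℚ)} (hC : IsAlgCone C)
    (hD : IsAlgCone D) : IsAlgCone (C ∩ D) := by
  classical
  obtain ⟨Z, P, rfl⟩ := hC
  obtain ⟨Y, Q, rfl⟩ := hD
  let V := MvPolynomial β ℚ
  let I := Ideal.span (Z : Set V)
  let J := Ideal.span (Y : Set V)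
  let inl := LinearMap.inl ℚ V V
  let inr := LinearMap.inr ℚ V V
  -- The intersection is the preimage, under the diagonal map, of the product of the two algebraic
  -- cones.
  obtain ⟨R, hR⟩ := exists_finset_preimage_add_hull (LinearMap.prod LinearMap.id LinearMap.id)
    ((I.restrictScalars ℚ).prod (J.restrictScalars ℚ)) (P.image inl ∪ Q.image inr)
  have hhull : ∀ c : V × V, c ∈ PointedCone.hull ℚ ((P.image inl ∪ Q.image inr : Finset _) :
      Set (V × V)) ↔ c.1 ∈ PointedCone.hull ℚ (P : Set V) ∧ c.2 ∈ PointedCone.hull ℚ (Q : Set V) := by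
    intro c
    constructor
    · intro hc
      have hle : PointedCone.hull ℚ ((P.image inl ∪ Q.image inr : Finset _) : Set (V × V)) ≤
          (PointedCone.hull ℚ (P : Set V)).comap (LinearMap.fst ℚ V V) ⊓
          (PointedCone.hull ℚ (Q : Set V)).comap (LinearMap.snd ℚ V V) := by
        refine Submodule.span_le.2 ?_
        rw [Finset.coe_union, Finset.coe_image, Finset.coe_image]
        rintro _ (⟨x, hx, rfl⟩ | ⟨x, hx, rfl⟩)
        · exact ⟨PointedCone.subset_hull hx, zero_mem (PointedCone.hull ℚ (Q : Set V))⟩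
        · exact ⟨zero_mem (PointedCone.hull ℚ (P : Set V)), PointedCone.subset_hull hx⟩
      exact hle hc
    · rintro ⟨h1, h2⟩
      have h3 : PointedCone.hull ℚ (P : Set V) ≤ (PointedCone.hull ℚ
          ((P.image inl ∪ Q.image inr : Finset _) : Set (V × V))).comap inl := by
        refine Submodule.span_le.2 fun x hx => PointedCone.subset_hull ?_
        exact Finset.mem_union_left _ (Finset.mem_image_of_mem inl hx)
      have h4 : PointedCone.hull ℚ (Q : Set V) ≤ (PointedCone.hull ℚ
          ((P.image inl ∪ Q.image inr : Finset _) : Set (V × V))).comap inr := by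
        refine Submodule.span_le.2 fun x hx => PointedCone.subset_hull ?_
        exact Finset.mem_union_right _ (Finset.mem_image_of_mem inr hx)
      have hc : c = inl c.1 + inr c.2 :=
        Prod.ext (add_zero c.1).symm (zero_add c.2).symm
      have h5 : c.1 ∈ (PointedCone.hull ℚ
          ((P.image inl ∪ Q.image inr : Finset _) : Set (V × V))).comap inl := h3 h1
      have h6 : c.2 ∈ (PointedCone.hull ℚ
          ((P.image inl ∪ Q.image inr : Finset _) : Set (V × V))).comap inr := h4 h2
      rw [hc]
      exact add_mem (PointedCone.mem_comap.1 h5) (PointedCone.mem_comap.1 h6)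
  have h := isAlgCone_add (I ⊓ J) R
  convert h using 1
  have h5 : (((I.restrictScalars ℚ).prod (J.restrictScalars ℚ)).comap
      (LinearMap.prod LinearMap.id LinearMap.id) : Set V) = ((I ⊓ J : Ideal V) : Set V) := rfl
  rw [← h5, ← hR]
  ext x
  simp only [algCone, Set.mem_inter_iff, Set.mem_add, Set.mem_preimage, SetLike.mem_coe]
  constructor
  · rintro ⟨⟨i, hi, p, hp, hip⟩, j, hj, q, hq, hjq⟩
    exact ⟨(i, j), ⟨hi, hj⟩, (p, q), (hhull _).2 ⟨hp, hq⟩, Prod.ext hip hjq⟩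
  · rintro ⟨⟨i, j⟩, ⟨hi, hj⟩, ⟨p, q⟩, hc, hx⟩
    obtain ⟨hp, hq⟩ := (hhull _).1 hc
    exact ⟨⟨i, hi, p, hp, congrArg Prod.fst hx⟩, j, hj, q, hq, congrArg Prod.snd hx⟩

end AlgebraicCones

/-! ### Consequence cones of quantifier-free and existential formulas. -/

section Cubes

open FirstOrder FirstOrder.Language

/-- The polynomial of a term. -/
noncomputable def toPoly {β : Type*} : sig.Term β → MvPolynomial β ℚ
  | .var i => MvPolynomial.X i
  | .func Func.zero _ => 0
  | .func Func.one _ => 1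
  | .func Func.add ts => toPoly (ts 0) + toPoly (ts 1)
  | .func Func.mul ts => toPoly (ts 0) * toPoly (ts 1)

theorem IntRealRing.eval_eq_aeval {A : Type*} [CommRing A] [Algebra ℚ A] (S : IntRealRing A)
    {β : Type*} (t : sig.Term β) (w : β → A) : S.eval t w = MvPolynomial.aeval w (toPoly t) := by
  induction t with
  | var i => simp [toPoly]
  | func f ts ih =>
    cases f
    · simp only [toPoly, map_zero]; rfl
    · simp only [toPoly, map_one]; rfl
    · simp only [toPoly, map_add, ← ih]; rfl
    · simp only [toPoly, map_mul, ← ih]; rfl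

/-- The atoms `0 ≤ p`, `0 = p` and `Int(p)`. -/
inductive PolyAtom (β : Type*)
  | nonneg (p : MvPolynomial β ℚ)
  | zero (p : MvPolynomial β ℚ)
  | int (p : MvPolynomial β ℚ)

/-- Satisfaction of an atom in a linear integer/real ring. -/
def PolyAtom.Sat {A : Type*} [CommRing A] [Algebra ℚ A] (S : IntRealRing A) {β : Type*}
    (w : β → A) : PolyAtom β → Prop
  | nonneg p => MvPolynomial.aeval w p ∈ S.pos
  | zero p => MvPolynomial.aeval w p = 0
  | int p => MvPolynomial.aeval w p ∈ S.int

/-- A conjunction of atoms and negated atoms. -/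
structure Cube (β : Type*) where
  pos : List (PolyAtom β)
  neg : List (PolyAtom β)

/-- Satisfaction of a cube in a linear integer/real ring. -/
def Cube.Sat {A : Type*} [CommRing A] [Algebra ℚ A] (S : IntRealRing A) {β : Type*}
    (w : β → A) (c : Cube β) : Prop :=
  (∀ a ∈ c.pos, a.Sat S w) ∧ ∀ a ∈ c.neg, ¬ a.Sat S w

theorem exists_polyAtom {α : Type*} {n : ℕ} {φ : sig.BoundedFormula α n} (hφ : φ.IsAtomic) :
    ∃ a : PolyAtom (α ⊕ Fin n), ∀ (A : Type u) [CommRing A] [Algebra ℚ A] (S : IntRealRing A)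
      (v : α → A) (xs : Fin n → A), S.Holds φ v xs ↔ a.Sat S (Sum.elim v xs) := by
  cases hφ with
  | equal t₁ t₂ =>
    refine ⟨.zero (toPoly t₁ - toPoly t₂), fun A _ _ S v xs => ?_⟩
    let _ := S.toStructure
    refine (BoundedFormula.realize_bdEqual _ _).trans ?_
    change S.eval t₁ _ = S.eval t₂ _ ↔ MvPolynomial.aeval _ _ = 0
    rw [S.eval_eq_aeval, S.eval_eq_aeval, map_sub, sub_eq_zero]
  | rel R ts =>
    cases R
    · refine ⟨.nonneg (toPoly (ts 1) - toPoly (ts 0)), fun A _ _ S v xs => ?_⟩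
      let _ := S.toStructure
      refine BoundedFormula.realize_rel.trans ?_
      change S.eval (ts 1) _ - S.eval (ts 0) _ ∈ S.pos ↔ MvPolynomial.aeval _ _ ∈ S.pos
      rw [S.eval_eq_aeval, S.eval_eq_aeval, map_sub]
    · refine ⟨.int (toPoly (ts 0)), fun A _ _ S v xs => ?_⟩
      let _ := S.toStructure
      refine BoundedFormula.realize_rel.trans ?_
      change S.eval (ts 0) _ ∈ S.int ↔ MvPolynomial.aeval _ _ ∈ S.int
      rw [S.eval_eq_aeval]

/-- A quantifier-free formula and its negation are disjunctions of cubes. -/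
theorem exists_cubes {α : Type*} {n : ℕ} {φ : sig.BoundedFormula α n} (hφ : φ.IsQF) :
    ∃ l l' : List (Cube (α ⊕ Fin n)), ∀ (A : Type u) [CommRing A] [Algebra ℚ A]
      (S : IntRealRing A) (v : α → A) (xs : Fin n → A),
      (S.Holds φ v xs ↔ ∃ c ∈ l, c.Sat S (Sum.elim v xs)) ∧
      (¬ S.Holds φ v xs ↔ ∃ c ∈ l', c.Sat S (Sum.elim v xs)) := by
  -- Implication is the basic connective, so the induction must carry a disjunctive form of the
  -- negation as well.
  induction hφ with
  | falsum =>
    refine ⟨[], [⟨[], []⟩], fun A _ _ S v xs => ?_⟩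
    have : ¬ S.Holds (BoundedFormula.falsum : sig.BoundedFormula α n) v xs := id
    simp [this, Cube.Sat]
  | of_isAtomic h =>
    obtain ⟨a, ha⟩ := exists_polyAtom.{u} h
    refine ⟨[⟨[a], []⟩], [⟨[], [a]⟩], fun A _ _ S v xs => ?_⟩
    simp [ha, Cube.Sat]
  | @imp φ ψ _ _ ihφ ihψ =>
    obtain ⟨l₁, l₁', h₁⟩ := ihφ
    obtain ⟨l₂, l₂', h₂⟩ := ihψ
    refine ⟨l₁' ++ l₂, (l₁ ×ˢ l₂').map fun p => ⟨p.1.pos ++ p.2.pos, p.1.neg ++ p.2.neg⟩,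
      fun A _ _ S v xs => ?_⟩
    obtain ⟨h₁, h₁'⟩ := h₁ A S v xs
    obtain ⟨h₂, h₂'⟩ := h₂ A S v xs
    have himp : S.Holds (φ.imp ψ) v xs ↔ (S.Holds φ v xs → S.Holds ψ v xs) := Iff.rfl
    constructor
    · rw [himp, imp_iff_not_or, h₁', h₂]
      simp only [List.mem_append, or_and_right, exists_or]
    · rw [himp, Classical.not_imp, h₁, h₂']
      simp only [List.mem_map, List.mem_product, Prod.exists]
      constructor
      · rintro ⟨⟨c, hc, hc1, hc2⟩, d, hd, hd1, hd2⟩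
        refine ⟨_, ⟨c, d, ⟨hc, hd⟩, rfl⟩, fun a ha => ?_, fun a ha => ?_⟩
        · exact (List.mem_append.1 ha).elim (hc1 a) (hd1 a)
        · exact (List.mem_append.1 ha).elim (hc2 a) (hd2 a)
      · rintro ⟨_, ⟨c, d, ⟨hc, hd⟩, rfl⟩, h1, h2⟩
        exact ⟨⟨c, hc, fun a ha => h1 a (List.mem_append_left _ ha),
            fun a ha => h2 a (List.mem_append_left _ ha)⟩,
          d, hd, fun a ha => h1 a (List.mem_append_right _ ha),
            fun a ha => h2 a (List.mem_append_right _ ha)⟩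

/-- The polynomials that are nonnegative at all points that satisfy the cube. -/
def cubeCone {β : Type*} (c : Cube β) : Set (MvPolynomial β ℚ) :=
  {p | ∀ (A : Type u) [CommRing A] [Algebra ℚ A] [Nontrivial A] (S : IntRealRing A) (w : β → A),
    c.Sat S w → MvPolynomial.aeval w p ∈ S.pos}

/-- The polynomials asserted to be nonnegative by an atom. -/
noncomputable def PolyAtom.nonnegList {β : Type*} : PolyAtom β → List (MvPolynomial β ℚ)
  | nonneg p => [p]
  | zero p => [p, -p]
  | int _ => []

/-- The polynomials asserted to be integral by an atom. -/
def PolyAtom.intList {β : Type*} : PolyAtom β → List (MvPolynomial β ℚ)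
  | int p => [p]
  | _ => []

/-- The model on the quotient by the invertible elements of a regular cone. -/
def IsRegularCone.quotientModel {A : Type*} [CommRing A] [Algebra ℚ A] {Λ : AddSubgroup A}
    {C : PointedCone ℚ A} (hC : IsRegularCone Λ C) (h1 : 1 ∈ Λ) : IntRealRing (A ⧸ hC.units) where
  pos := C.map (Ideal.Quotient.mkₐ ℚ hC.units).toLinearMap
  int := Λ.map (Ideal.Quotient.mk hC.units).toAddMonoidHom
  one_mem_pos := ⟨1, hC.one_mem, map_one (Ideal.Quotient.mk hC.units)⟩
  eq_zero := by
    rintro _ ⟨x, hx, rfl⟩ ⟨y, hy, hxy⟩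
    change Ideal.Quotient.mk hC.units y = -Ideal.Quotient.mk hC.units x at hxy
    rw [← map_neg, Ideal.Quotient.eq] at hxy
    refine Ideal.Quotient.eq_zero_iff_mem.2 ⟨hx, ?_⟩
    exact hC.mem_of_sub_mem hy (by rw [← neg_sub]; exact neg_mem hxy)
  one_mem_int := ⟨1, h1, map_one (Ideal.Quotient.mk hC.units)⟩
  cut := by
    rintro _ ⟨x, hx, rfl⟩ n m hn ⟨y, hy, hxy⟩
    have hxy' : Ideal.Quotient.mk hC.units y =
        Ideal.Quotient.mk hC.units (n • x + m • 1) := by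
      rw [map_add, map_nsmul, map_zsmul, map_one]
      exact hxy
    rw [Ideal.Quotient.eq] at hxy'
    have h2 := hC.mem_of_sub_mem hy (x := n • x + m • 1) (by rw [← neg_sub]; exact neg_mem hxy')
    refine ⟨_, hC.cut x hx n m hn h2, ?_⟩
    change Ideal.Quotient.mk hC.units _ = _
    rw [map_add, map_zsmul, map_one]
    rfl

theorem IsRegularCone.mem_quotientModel_pos {A : Type*} [CommRing A] [Algebra ℚ A]
    {Λ : AddSubgroup A} {C : PointedCone ℚ A} (hC : IsRegularCone Λ C) (h1 : 1 ∈ Λ) {x : A} :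
    Ideal.Quotient.mk hC.units x ∈ (hC.quotientModel h1).pos ↔ x ∈ C := by
  refine ⟨?_, fun h => ⟨x, h, rfl⟩⟩
  rintro ⟨y, hy, hxy⟩
  have hxy' : Ideal.Quotient.mk hC.units x = Ideal.Quotient.mk hC.units y := hxy.symm
  exact hC.mem_of_sub_mem hy (Ideal.Quotient.eq.1 hxy')

theorem IsRegularCone.mem_quotientModel_int {A : Type*} [CommRing A] [Algebra ℚ A]
    {Λ : AddSubgroup A} {C : PointedCone ℚ A} (hC : IsRegularCone Λ C) (h1 : 1 ∈ Λ) {x : A} :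
    Ideal.Quotient.mk hC.units x ∈ (hC.quotientModel h1).int ↔ ∃ y ∈ Λ, x - y ∈ hC.units := by
  constructor
  · rintro ⟨y, hy, hxy⟩
    exact ⟨y, hy, Ideal.Quotient.eq.1 hxy.symm⟩
  · rintro ⟨y, hy, hxy⟩
    exact ⟨y, hy, (Ideal.Quotient.eq.2 hxy).symm⟩

/-- The consequences of a cube form an algebraic cone. -/
theorem isAlgCone_cubeCone {β : Type u} [Finite β] (c : Cube β) :
    IsAlgCone (cubeCone.{u} c) := by
  classical
  by_cases hsat : ∃ (A : Type u) (_ : CommRing A) (_ : Algebra ℚ A) (_ : Nontrivial A)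
      (S : IntRealRing A) (w : β → A), c.Sat S w
  swap
  · have : cubeCone.{u} c = Set.univ := by
      refine Set.eq_univ_of_forall fun p A _ _ _ S w h => ?_
      exact absurd ⟨A, _, _, inferInstance, S, w, h⟩ hsat
    rw [this]
    exact isAlgCone_univ
  let B : Finset (MvPolynomial β ℚ) := (c.pos.flatMap PolyAtom.nonnegList).toFinset
  let T : Finset (MvPolynomial β ℚ) := insert 1 (c.pos.flatMap PolyAtom.intList).toFinset
  let Λ : AddSubgroup (MvPolynomial β ℚ) := AddSubgroup.closure (T : Set (MvPolynomial β ℚ))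
  have hΛ : Λ.FG := ⟨T, rfl⟩
  have h1Λ : 1 ∈ Λ := AddSubgroup.subset_closure (Finset.mem_insert_self _ _)
  have hC : IsRegularCone Λ (leastCone Λ (B : Set (MvPolynomial β ℚ))) :=
    isRegularCone_leastCone Λ B
  set C := leastCone Λ (B : Set (MvPolynomial β ℚ)) with hCdef
  have hint : ∀ (A : Type u) [CommRing A] [Algebra ℚ A] (S : IntRealRing A) (w : β → A),
      (∀ a ∈ c.pos, a.Sat S w) → ∀ p ∈ Λ, MvPolynomial.aeval w p ∈ S.int := by
    intro A _ _ S w h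
    suffices Λ ≤ S.int.comap (MvPolynomial.aeval w : MvPolynomial β ℚ →ₐ[ℚ] A).toRingHom.toAddMonoidHom
      from fun p hp => this hp
    refine (AddSubgroup.closure_le _).2 fun p hp => ?_
    rcases Finset.mem_insert.1 hp with rfl | hp
    · change MvPolynomial.aeval w 1 ∈ S.int
      rw [map_one]
      exact S.one_mem_int
    · obtain ⟨a, ha, hpa⟩ := List.mem_flatMap.1 (List.mem_toFinset.1 hp)
      have := h a ha
      cases a with
      | nonneg q => simp [PolyAtom.intList] at hpa
      | zero q => simp [PolyAtom.intList] at hpa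
      | int q =>
        rw [PolyAtom.intList, List.mem_singleton] at hpa
        subst hpa
        exact this
  -- Soundness: the pullback of the positive cone of any model along a satisfying valuation is a
  -- regular cone containing `B`, hence contains the least one.
  have hpos : ∀ (A : Type u) [CommRing A] [Algebra ℚ A] (S : IntRealRing A) (w : β → A),
      (∀ a ∈ c.pos, a.Sat S w) → ∀ p ∈ C, MvPolynomial.aeval w p ∈ S.pos := by
    intro A _ _ S w h p hp
    let D := S.pos.comap (MvPolynomial.aeval w : MvPolynomial β ℚ →ₐ[ℚ] A).toLinearMap
    have hD : ∀ q, q ∈ D ↔ MvPolynomial.aeval w q ∈ S.pos := fun q => Iff.rfl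
    refine (hD p).1 (mem_leastCone.1 hp D ⟨?_, ?_, ?_⟩ ?_)
    · rw [hD, map_one]
      exact S.one_mem_pos
    · intro x hx n m hn hxm
      rw [hD] at *
      rw [map_add, map_nsmul, map_zsmul, map_one] at hxm
      rw [map_add, map_zsmul, map_one]
      exact S.cut _ (hint A S w h x hx) n m hn hxm
    · intro x h1 h2 a
      rw [hD] at *
      rw [map_neg] at h2
      rw [map_mul, S.eq_zero _ h1 h2, mul_zero]
      exact zero_mem _
    · intro q hq
      obtain ⟨a, ha, hqa⟩ := List.mem_flatMap.1 (List.mem_toFinset.1 hq)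
      have := h a ha
      cases a with
      | nonneg q =>
        rw [PolyAtom.nonnegList, List.mem_singleton] at hqa
        subst hqa
        exact this
      | zero r =>
        have hr : MvPolynomial.aeval w r = 0 := this
        simp only [PolyAtom.nonnegList, List.mem_cons, List.not_mem_nil, or_false] at hqa
        rw [SetLike.mem_coe, hD]
        rcases hqa with rfl | rfl
        · rw [hr]; exact zero_mem _
        · rw [map_neg, hr, neg_zero]; exact zero_mem _
      | int q => simp [PolyAtom.nonnegList] at hqa
  obtain ⟨A, _, _, _, S, w, hS1, hS2⟩ := hsat
  have hne : -1 ∉ C := by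
    intro h
    have := hpos A S w hS1 _ h
    rw [map_neg, map_one] at this
    exact one_ne_zero (S.eq_zero 1 S.one_mem_pos this)
  -- Completeness: in the quotient by the units of `C`, with the variables valued at their own
  -- classes, exactly the members of `C` are nonnegative.
  have huniv : cubeCone.{u} c = (C : Set (MvPolynomial β ℚ)) := by
    refine Set.Subset.antisymm ?_ fun p hp A _ _ _ S w h => hpos A S w h.1 p hp
    intro p hp
    have hnt : Nontrivial (MvPolynomial β ℚ ⧸ hC.units) := by
      refine Ideal.Quotient.nontrivial_iff.2 ((Ideal.ne_top_iff_one _).2 fun h => hne h.2)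
    let w₀ : β → MvPolynomial β ℚ ⧸ hC.units := fun i => Ideal.Quotient.mk _ (MvPolynomial.X i)
    have hw₀ : ∀ q, MvPolynomial.aeval w₀ q = Ideal.Quotient.mk hC.units q := by
      intro q
      have : MvPolynomial.aeval w₀ = Ideal.Quotient.mkₐ ℚ hC.units := by
        ext i
        simp [w₀]
      rw [this]
      rfl
    have hunit : ∀ q, q ∈ hC.units → MvPolynomial.aeval w q = 0 := by
      rintro q ⟨h1, h2⟩
      refine S.eq_zero _ (hpos A S w hS1 q h1) ?_
      rw [← map_neg]
      exact hpos A S w hS1 _ h2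
    have hmodel := hp _ (hC.quotientModel h1Λ) w₀ ⟨?_, ?_⟩
    · rwa [hw₀, hC.mem_quotientModel_pos] at hmodel
    · intro a ha
      cases a with
      | nonneg q =>
        change MvPolynomial.aeval w₀ q ∈ _
        rw [hw₀, hC.mem_quotientModel_pos]
        exact subset_leastCone _ _ (List.mem_toFinset.2 (List.mem_flatMap.2
          ⟨_, ha, by simp [PolyAtom.nonnegList]⟩))
      | zero q =>
        change MvPolynomial.aeval w₀ q = 0
        rw [hw₀, Ideal.Quotient.eq_zero_iff_mem]
        constructor
        · exact subset_leastCone _ _ (List.mem_toFinset.2 (List.mem_flatMap.2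
            ⟨_, ha, by simp [PolyAtom.nonnegList]⟩))
        · exact subset_leastCone _ _ (List.mem_toFinset.2 (List.mem_flatMap.2
            ⟨_, ha, by simp [PolyAtom.nonnegList]⟩))
      | int q =>
        change MvPolynomial.aeval w₀ q ∈ _
        rw [hw₀]
        refine ⟨q, AddSubgroup.subset_closure (Finset.mem_insert_of_mem ?_), rfl⟩
        exact List.mem_toFinset.2 (List.mem_flatMap.2 ⟨_, ha, by simp [PolyAtom.intList]⟩)
    -- Negated atoms add no consequences: an atom true in the generic model is true at every point
    -- satisfying the positive atoms, in particular at the given `w`, which satisfies the whole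
    -- cube.
    · intro a ha hcon
      refine hS2 a ha ?_
      cases a with
      | nonneg q =>
        change MvPolynomial.aeval w₀ q ∈ _ at hcon
        rw [hw₀, hC.mem_quotientModel_pos] at hcon
        exact hpos A S w hS1 q hcon
      | zero q =>
        change MvPolynomial.aeval w₀ q = 0 at hcon
        rw [hw₀, Ideal.Quotient.eq_zero_iff_mem] at hcon
        exact hunit q hcon
      | int q =>
        change MvPolynomial.aeval w₀ q ∈ _ at hcon
        rw [hw₀, hC.mem_quotientModel_int] at hcon
        obtain ⟨y, hy, hqy⟩ := hcon
        have h3 := hunit _ hqy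
        rw [map_sub, sub_eq_zero] at h3
        change MvPolynomial.aeval w q ∈ S.int
        rw [h3]
        exact hint A S w hS1 y hy
  obtain ⟨R, hR⟩ := exists_finset_leastCone hΛ h1Λ B hne
  rw [huniv, hCdef, hR]
  exact isAlgCone_add _ R

/-- The polynomials that are nonnegative at all points that satisfy a formula. -/
def boundedCone {α : Type u} {n : ℕ} (φ : sig.BoundedFormula α n) :
    Set (MvPolynomial (α ⊕ Fin n) ℚ) :=
  {p | ∀ (A : Type u) [CommRing A] [Algebra ℚ A] [Nontrivial A] (S : IntRealRing A) (v : α → A)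
    (xs : Fin n → A), S.Holds φ v xs → MvPolynomial.aeval (Sum.elim v xs) p ∈ S.pos}

/-- A disjunction of cubes entails exactly what all its cubes entail, so the cubes' cones are
intersected. -/
theorem isAlgCone_boundedCone_of_isQF {α : Type u} [Finite α] {n : ℕ} {φ : sig.BoundedFormula α n}
    (hφ : φ.IsQF) : IsAlgCone (boundedCone φ) := by
  obtain ⟨l, _, hl⟩ := exists_cubes.{u} hφ
  have hlist : ∀ l : List (Cube (α ⊕ Fin n)),
      IsAlgCone {p | ∀ c ∈ l, p ∈ cubeCone.{u} c} := by
    intro l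
    induction l with
    | nil => simpa using isAlgCone_univ
    | cons c l ih =>
      have := (isAlgCone_cubeCone c).inter ih
      convert this using 1
      ext p
      simp
  convert hlist l using 1
  ext p
  constructor
  · intro hp c hc A _ _ _ S w hw
    have := hp A S (w ∘ Sum.inl) (w ∘ Sum.inr)
    rw [(hl A S _ _).1, Sum.elim_comp_inl_inr] at this
    exact this ⟨c, hc, hw⟩
  · intro hp A _ _ _ S v xs h
    obtain ⟨c, hc, hcs⟩ := ((hl A S v xs).1).1 h
    exact hp c hc A S _ hcs

/-- The consequences of an existential formula form an algebraic cone. -/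
theorem isAlgCone_boundedCone {α : Type u} [Finite α] {n : ℕ} {φ : sig.BoundedFormula α n}
    (hφ : φ.IsExistential) : IsAlgCone (boundedCone φ) := by
  induction hφ with
  | of_isQF h => exact isAlgCone_boundedCone_of_isQF h
  | @ex n φ _ ih =>
    -- Projecting out the last variable means keeping the consequences in which it does not occur.
    have := ih.preimage (MvPolynomial.rename (Sum.map id Fin.castSucc) :
      MvPolynomial (α ⊕ Fin n) ℚ →ₐ[ℚ] MvPolynomial (α ⊕ Fin (n + 1)) ℚ)
    convert this using 1
    ext p
    have hval : ∀ {A : Type u} [CommRing A] [Algebra ℚ A] (v : α → A) (xs : Fin n → A) (a : A),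
        MvPolynomial.aeval (Sum.elim v (Fin.snoc xs a))
          (MvPolynomial.rename (Sum.map id Fin.castSucc) p) =
        MvPolynomial.aeval (Sum.elim v xs) p := by
      intro A _ _ v xs a
      rw [MvPolynomial.aeval_rename]
      congr 2
      ext i
      rcases i with i | i <;> simp
    have hex : ∀ {A : Type u} [CommRing A] [Algebra ℚ A] (S : IntRealRing A) (v : α → A)
        (xs : Fin n → A), S.Holds φ.ex v xs ↔ ∃ a, S.Holds φ v (Fin.snoc xs a) := by
      intro A _ _ S v xs
      let _ := S.toStructure
      exact BoundedFormula.realize_ex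
    constructor
    · intro hp A _ _ _ S v xs h
      have h1 := hp A S v (xs ∘ Fin.castSucc) ((hex S _ _).2 ⟨xs (Fin.last n), by
        convert h using 1
        exact Fin.snoc_init_self xs⟩)
      rw [← hval v _ (xs (Fin.last n))] at h1
      convert h1 using 4
      exact (Fin.snoc_init_self xs).symm
    · intro hp A _ _ _ S v xs h
      obtain ⟨a, ha⟩ := (hex S v xs).1 h
      have := hp A S v (Fin.snoc xs a) ha
      rwa [hval] at this

end Cubes

/-! ### Consequence cones of transition formulas. -/

section Entailment

variable {α : Type u}

theorem entails_iff (F G : sig.Formula α) : Entails F G ↔ ∀ (A : Type u) [CommRing A]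
    [Algebra ℚ A] [Nontrivial A] (S : IntRealRing A) (v : α → A) (xs : Fin 0 → A),
    S.Holds F v xs → S.Holds G v xs :=
  imp_iff F G

theorem aeval_rename_inl {β : Type*} {A : Type*} [CommRing A] [Algebra ℚ A] (v : α → A) (w : β → A)
    (p : MvPolynomial α ℚ) : MvPolynomial.aeval (Sum.elim v w) (MvPolynomial.rename Sum.inl p) =
      MvPolynomial.aeval v p := by
  rw [MvPolynomial.aeval_rename, Sum.elim_comp_inl]

theorem mem_consequenceCone {F : sig.Formula α} {p : MvPolynomial α ℚ} :
    p ∈ consequenceCone F ↔ ∀ (A : Type u) [CommRing A] [Algebra ℚ A] [Nontrivial A]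
      (S : IntRealRing A) (v : α → A) (xs : Fin 0 → A), S.Holds F v xs →
        MvPolynomial.aeval v p ∈ S.pos := by
  refine (entails_iff _ _).trans ?_
  simp only [IntRealRing.holds_fNonneg, aeval_rename_inl]

theorem entailsZero_iff {F : sig.Formula α} {p : MvPolynomial α ℚ} :
    EntailsZero F p ↔ ∀ (A : Type u) [CommRing A] [Algebra ℚ A] [Nontrivial A]
      (S : IntRealRing A) (v : α → A) (xs : Fin 0 → A), S.Holds F v xs →
        MvPolynomial.aeval v p = 0 := by
  refine (entails_iff _ _).trans ?_
  simp only [IntRealRing.holds_fZero, aeval_rename_inl]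

theorem consequenceCone_anti {F G : sig.Formula α} (h : Entails F G) :
    consequenceCone G ⊆ consequenceCone F := fun _ hp =>
  FirstOrder.Language.Theory.Imp.trans h hp

/-- The consequence cone of a transition formula is an algebraic cone. -/
theorem IsTransitionFormula.isAlgCone_consequenceCone {X : Type u} [Finite X]
    {F : sig.Formula (X ⊕ X)} (hF : IsTransitionFormula F) : IsAlgCone (consequenceCone F) := by
  obtain ⟨E, hE, hFE⟩ := hF
  have h1 := (entails_iff F E).1 hFE.mp
  have h2 := (entails_iff E F).1 hFE.mpr
  have := (isAlgCone_boundedCone hE).preimage (MvPolynomial.rename Sum.inl)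
  convert this using 1
  ext p
  rw [mem_consequenceCone]
  constructor
  · intro h A _ _ _ S v xs hE
    rw [aeval_rename_inl]
    exact h A S v xs (h2 A S v xs hE)
  · intro h A _ _ _ S v xs hF
    have := h A S v xs (h1 A S v xs hF)
    rwa [aeval_rename_inl] at this

end Entailment

/-! ### Restriction to polynomials linear in the difference variables. -/

section LinearCones

variable {V W : Type*} [AddCommGroup V] [Module ℚ V] [AddCommGroup W] [Module ℚ W]

/-- Lets a finite-dimensional subspace be absorbed into a finitely generated cone. -/
theorem mem_hull_union_neg (s : Set V) {x : V} (hx : x ∈ Submodule.span ℚ s) :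
    x ∈ PointedCone.hull ℚ (s ∪ -s) := by
  have hneg : ∀ y ∈ PointedCone.hull ℚ (s ∪ -s), -y ∈ PointedCone.hull ℚ (s ∪ -s) := by
    intro y hy
    have hle : PointedCone.hull ℚ (s ∪ -s) ≤
        (PointedCone.hull ℚ (s ∪ -s)).comap (-LinearMap.id) := by
      refine Submodule.span_le.2 ?_
      rintro z (hz | hz)
      · exact PointedCone.subset_hull (Or.inr (by simpa using hz))
      · exact PointedCone.subset_hull (Or.inl hz)
    exact hle hy
  induction hx using Submodule.span_induction with
  | mem x h => exact PointedCone.subset_hull (Or.inl h)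
  | zero => exact zero_mem _
  | add x y _ _ hx hy => exact add_mem hx hy
  | smul q x _ hx =>
    rcases le_total 0 q with hq | hq
    · exact PointedCone.smul_mem _ hq hx
    · rw [← neg_neg q, neg_smul, ← smul_neg]
      exact PointedCone.smul_mem _ (neg_nonneg.2 hq) (hneg x hx)

/-- A subspace is the sum of its intersection with the kernel of a map to a finite-dimensional
space and a finitely generated cone. -/
theorem exists_finset_ker_add_hull [FiniteDimensional ℚ V] (f : W →ₗ[ℚ] V) (N : Submodule ℚ W) :
    ∃ R : Finset W, (N : Set W) =
      ((N ⊓ LinearMap.ker f : Submodule ℚ W) : Set W) +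
        (PointedCone.hull ℚ (R : Set W) : Set W) := by
  classical
  -- Lifts of finitely many generators of the image of `N` span a complement up to the kernel; with
  -- their negatives they span it as a cone.
  obtain ⟨T, hT⟩ := (IsNoetherian.noetherian (N.map f) : (N.map f).FG)
  have hTN : ∀ t ∈ T, ∃ w ∈ N, f w = t := fun t ht =>
    (hT ▸ Submodule.subset_span ht : t ∈ N.map f)
  choose! σ hσN hσ using hTN
  have hspanN : Submodule.span ℚ (σ '' (T : Set V)) ≤ N := by
    refine Submodule.span_le.2 ?_
    rintro _ ⟨t, ht, rfl⟩
    exact hσN t ht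
  have hspanf : (Submodule.span ℚ (σ '' (T : Set V))).map f = N.map f := by
    rw [Submodule.map_span, Set.image_image, ← hT]
    congr 1
    ext x
    constructor
    · rintro ⟨t, ht, rfl⟩
      change f (σ t) ∈ (T : Set V)
      rwa [hσ t ht]
    · exact fun hx => ⟨x, hx, hσ x hx⟩
  refine ⟨T.image σ ∪ (T.image σ).image (fun x => -x), ?_⟩
  have hcoe : ((T.image σ ∪ (T.image σ).image (fun x => -x) : Finset W) : Set W) =
      σ '' (T : Set V) ∪ -(σ '' (T : Set V)) := by
    rw [Finset.coe_union, Finset.coe_image, Finset.coe_image, Finset.coe_image,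
      Set.image_neg_eq_neg]
  rw [hcoe]
  ext x
  simp only [Set.mem_add, SetLike.mem_coe]
  constructor
  · intro hx
    have : f x ∈ (Submodule.span ℚ (σ '' (T : Set V))).map f := hspanf ▸ ⟨x, hx, rfl⟩
    obtain ⟨y, hy, hyx⟩ := this
    refine ⟨x - y, ⟨sub_mem hx (hspanN hy), ?_⟩, y, mem_hull_union_neg _ hy, sub_add_cancel _ _⟩
    rw [SetLike.mem_coe, LinearMap.mem_ker, map_sub, hyx, sub_self]
  · rintro ⟨y, hy, z, hz, rfl⟩
    refine add_mem hy.1 ?_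
    have h1 : z ∈ Submodule.span ℚ (σ '' (T : Set V) ∪ -(σ '' (T : Set V))) :=
      PointedCone.hull_le_span ℚ _ hz
    refine Submodule.span_le.2 ?_ h1
    rintro w (hw | hw)
    · exact hspanN (Submodule.subset_span hw)
    · rw [SetLike.mem_coe, ← neg_mem_iff]
      exact hspanN (Submodule.subset_span hw)

theorem image_hull (f : W →ₗ[ℚ] V) (s : Set W) :
    f '' (PointedCone.hull ℚ s : Set W) = (PointedCone.hull ℚ (f '' s) : Set V) := by
  have h := Submodule.map_span (f : W →ₗ[{c : ℚ // 0 ≤ c}] V) s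
  exact congrArg (fun p : Submodule {c : ℚ // 0 ≤ c} V => (p : Set V)) h

instance finiteDimensional_linTerms {X : Type*} [Finite X] :
    FiniteDimensional ℚ (linTerms X) :=
  FiniteDimensional.span_of_finite ℚ (Set.finite_range _)

/-- The part of an algebraic cone that is linear in the difference variables is finitely
generated in the sense of `linCone`. -/
theorem IsAlgCone.exists_linCone {X : Type*} [Finite X] {n : ℕ}
    {C : Set (MvPolynomial (X ⊕ Fin n) ℚ)} (hC : IsAlgCone C) :
    ∃ (V : Finset (MvPolynomial (Fin n) ℚ)) (R : Finset (MvPolynomial (X ⊕ Fin n) ℚ)),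
      linCone V R = C ∩ linPlusPoly X n := by
  classical
  obtain ⟨Z, P, rfl⟩ := hC
  let J := Ideal.span (Z : Set (MvPolynomial (X ⊕ Fin n) ℚ))
  let ρ : MvPolynomial (Fin n) ℚ →ₐ[ℚ] MvPolynomial (X ⊕ Fin n) ℚ := MvPolynomial.rename Sum.inr
  let g : linTerms X × MvPolynomial (Fin n) ℚ →ₗ[ℚ] MvPolynomial (X ⊕ Fin n) ℚ :=
    ((MvPolynomial.rename Sum.inl).toLinearMap.comp (linTerms X).subtype).coprod ρ.toLinearMap
  have hg : ∀ p, g p = MvPolynomial.rename Sum.inl (p.1 : MvPolynomial X ℚ) +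
      MvPolynomial.rename Sum.inr p.2 := fun _ => rfl
  have hrange : Set.range g = linPlusPoly X n := by
    ext p
    constructor
    · rintro ⟨⟨d, k⟩, rfl⟩
      exact ⟨d, d.2, k, rfl⟩
    · rintro ⟨d, hd, k, rfl⟩
      exact ⟨(⟨d, hd⟩, k), rfl⟩
  obtain ⟨R₀, hR₀⟩ := exists_finset_preimage_add_hull g (J.restrictScalars ℚ) P
  -- The pairs that `g` sends into `J` form only a rational subspace. Its elements with zero linear
  -- part give the ideal `J.comap ρ`, generated by `V`; modulo these it embeds in the
  -- finite-dimensional `linTerms X`, so finitely many cone generators make up the rest.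
  obtain ⟨R₁, hR₁⟩ := exists_finset_ker_add_hull (LinearMap.fst ℚ (linTerms X)
    (MvPolynomial (Fin n) ℚ)) ((J.restrictScalars ℚ).comap g)
  obtain ⟨V, hV⟩ := (isNoetherianRing_iff_ideal_fg _).1 inferInstance (J.comap ρ)
  refine ⟨V, R₁.image g ∪ R₀.image g, ?_⟩
  have hker : g '' (((J.restrictScalars ℚ).comap g ⊓ LinearMap.ker (LinearMap.fst ℚ (linTerms X)
      (MvPolynomial (Fin n) ℚ)) : Submodule ℚ _) : Set _) =
      ρ '' (J.comap ρ : Set (MvPolynomial (Fin n) ℚ)) := by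
    ext p
    constructor
    · rintro ⟨⟨d, k⟩, ⟨h1, h2⟩, rfl⟩
      have hd : d = 0 := h2
      subst hd
      have hgk : g (0, k) = ρ k := by simp [hg, ρ]
      refine ⟨k, ?_, hgk.symm⟩
      change ρ k ∈ J
      rw [← hgk]
      exact h1
    · rintro ⟨k, hk, rfl⟩
      have hgk : g (0, k) = ρ k := by simp [hg, ρ]
      refine ⟨(0, k), ⟨?_, rfl⟩, hgk⟩
      change g (0, k) ∈ J
      rw [hgk]
      exact hk
  have hL : linCone V (R₁.image g ∪ R₀.image g) = ρ '' (J.comap ρ : Set (MvPolynomial (Fin n) ℚ)) +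
      (PointedCone.hull ℚ ((R₁.image g ∪ R₀.image g : Finset (MvPolynomial (X ⊕ Fin n) ℚ)) :
        Set (MvPolynomial (X ⊕ Fin n) ℚ)) : Set (MvPolynomial (X ⊕ Fin n) ℚ)) := by
    rw [linCone, hV]
  have hA : algCone Z P = (J.restrictScalars ℚ : Set (MvPolynomial (X ⊕ Fin n) ℚ)) +
      (PointedCone.hull ℚ (P : Set (MvPolynomial (X ⊕ Fin n) ℚ)) :
        Set (MvPolynomial (X ⊕ Fin n) ℚ)) := rfl
  rw [hL, hA, ← hrange, ← Set.image_preimage_eq_inter_range, hR₀, hR₁, Set.image_add, Set.image_add,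
    hker, image_hull, image_hull, add_assoc, ← Finset.coe_image, ← Finset.coe_image,
    Finset.coe_union]
  congr 1
  have := Submodule.span_union (R := {c : ℚ // 0 ≤ c})
    ((R₁.image g : Finset (MvPolynomial (X ⊕ Fin n) ℚ)) : Set (MvPolynomial (X ⊕ Fin n) ℚ))
    ((R₀.image g : Finset (MvPolynomial (X ⊕ Fin n) ℚ)) : Set (MvPolynomial (X ⊕ Fin n) ℚ))
  rw [PointedCone.hull, this, Submodule.coe_sup]

end LinearCones

/-! ### Linear invariants and the existence of the closure operator. -/

section Existence

variable {X : Type u}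

/-- The linear invariants of a formula as a subspace. -/
def linInvSubmodule (F : sig.Formula (X ⊕ X)) : Submodule ℚ (MvPolynomial X ℚ) where
  carrier := linInv F
  zero_mem' := ⟨zero_mem _, entailsZero_iff.2 fun A _ _ _ S v xs _ => by simp [pre, post]⟩
  add_mem' := by
    rintro p q ⟨hp, hp'⟩ ⟨hq, hq'⟩
    refine ⟨add_mem hp hq, entailsZero_iff.2 fun A _ _ _ S v xs h => ?_⟩
    have h1 := entailsZero_iff.1 hp' A S v xs h
    have h2 := entailsZero_iff.1 hq' A S v xs h
    rw [pre, post, map_sub] at h1 h2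
    rw [pre, post, map_add, map_add, map_sub, map_add, map_add]
    linear_combination h1 + h2
  smul_mem' := by
    rintro c p ⟨hp, hp'⟩
    refine ⟨Submodule.smul_mem _ c hp, entailsZero_iff.2 fun A _ _ _ S v xs h => ?_⟩
    have h1 := entailsZero_iff.1 hp' A S v xs h
    rw [pre, post] at h1 ⊢
    rw [map_smul, map_smul, ← smul_sub, map_smul, h1, smul_zero]

variable [Fintype X]

/-- A transition formula has an approximate reflexive transitive closure. -/
theorem IsTransitionFormula.exists_isStar {F : sig.Formula (X ⊕ X)} (hF : IsTransitionFormula F) :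
    ∃ S, IsStar F S := by
  have hle : linInvSubmodule F ≤ linTerms X := fun _ h => h.1
  have hfin : FiniteDimensional ℚ (linInvSubmodule F) := Submodule.finiteDimensional_of_le hle
  let b := Module.finBasis ℚ (linInvSubmodule F)
  let a : Fin _ → MvPolynomial X ℚ := fun i => b i
  obtain ⟨Z, P, hZP⟩ := hF.isAlgCone_consequenceCone
  have hC : IsAlgCone (algCone Z P) := ⟨Z, P, rfl⟩
  obtain ⟨Z', P', hZP'⟩ := hC.preimage (deltaInv a)
  have hC' : IsAlgCone (algCone Z' P') := ⟨Z', P', rfl⟩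
  obtain ⟨V, R, hVR⟩ := hC'.exists_linCone
  refine ⟨_, expFormula a V R, ⟨_, a, Z, P, Z', P', V, R, ?_, ?_, hZP, hZP', hVR, rfl⟩, rfl⟩
  · exact b.linearIndependent.map' (linInvSubmodule F).subtype (Submodule.ker_subtype _)
  · have h1 : Set.range a = (linInvSubmodule F).subtype '' Set.range b := by
      rw [← Set.range_comp]
      rfl
    rw [h1, Submodule.span_image, b.span_eq, Submodule.map_subtype_top]
    rfl

end Existence

/-! ### Closed forms and the monotonicity of the closure operator. -/

section Monotonicity

variable {X : Type u} {n : ℕ}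

theorem projK_rename_inr (k : MvPolynomial (Fin n) ℚ) :
    projK (X := X) (MvPolynomial.rename Sum.inr k) = k := by
  rw [projK, MvPolynomial.aeval_rename, Sum.elim_comp_inr]
  exact MvPolynomial.aeval_X_left_apply k

theorem projK_rename_inl {d : MvPolynomial X ℚ} (hd : d ∈ linTerms X) :
    projK (n := n) (MvPolynomial.rename Sum.inl d) = 0 := by
  rw [projK, MvPolynomial.aeval_rename, Sum.elim_comp_inl]
  induction hd using Submodule.span_induction with
  | mem x h =>
    obtain ⟨i, rfl⟩ := h
    simp
  | zero => simp
  | add x y _ _ hx hy => rw [map_add, hx, hy, add_zero]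
  | smul q x _ hx => rw [map_smul, hx, smul_zero]

variable [Fintype X]

theorem projD_add (p q : MvPolynomial (X ⊕ Fin n) ℚ) : projD (p + q) = projD p + projD q := by
  simp only [projD, MvPolynomial.coeff_add, map_add, add_mul, Finset.sum_add_distrib]

theorem projD_smul (c : ℚ) (p : MvPolynomial (X ⊕ Fin n) ℚ) : projD (c • p) = c • projD p := by
  simp only [projD, MvPolynomial.coeff_smul, Finset.smul_sum, smul_eq_mul, map_mul, mul_assoc]
  simp only [MvPolynomial.smul_eq_C_mul]

theorem projD_rename_inr (k : MvPolynomial (Fin n) ℚ) :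
    projD (X := X) (MvPolynomial.rename Sum.inr k) = 0 := by
  refine Finset.sum_eq_zero fun x _ => ?_
  rw [MvPolynomial.coeff_rename_eq_zero, map_zero, zero_mul]
  intro u hu
  have := DFunLike.congr_fun hu (Sum.inl x)
  rw [Finsupp.mapDomain_of_notMem_range _ _ (by simp)] at this
  simp at this

theorem projD_rename_inl {d : MvPolynomial X ℚ} (hd : d ∈ linTerms X) :
    projD (n := n) (MvPolynomial.rename Sum.inl d) = d := by
  classical
  induction hd using Submodule.span_induction with
  | mem x h =>
    obtain ⟨i, rfl⟩ := h
    rw [MvPolynomial.rename_X, projD, Finset.sum_eq_single i]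
    · simp
    · intro j _ hj
      rw [MvPolynomial.coeff_X, if_neg, map_zero, zero_mul]
      intro h
      have := Finsupp.single_left_injective one_ne_zero h
      exact hj (Sum.inl_injective this).symm
    · simp
  | zero => simp [projD]
  | add x y _ _ hx hy => rw [map_add, projD_add, hx, hy]
  | smul q x _ hx => rw [map_smul, projD_smul, hx]

theorem closedForm_add (a : Fin n → MvPolynomial X ℚ) (p q : MvPolynomial (X ⊕ Fin n) ℚ) :
    closedForm a (p + q) = closedForm a p + closedForm a q := by
  simp only [closedForm, projD_add, projK, pre, map_add]
  ring

theorem closedForm_smul (a : Fin n → MvPolynomial X ℚ) (c : ℚ)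
    (p : MvPolynomial (X ⊕ Fin n) ℚ) : closedForm a (c • p) = c • closedForm a p := by
  simp only [closedForm, projD_smul, projK, pre, map_smul, smul_add, mul_smul_comm]

theorem closedForm_rename_add (a : Fin n → MvPolynomial X ℚ) {d : MvPolynomial X ℚ}
    (hd : d ∈ linTerms X) (k : MvPolynomial (Fin n) ℚ) :
    closedForm a (MvPolynomial.rename Sum.inl d + MvPolynomial.rename Sum.inr k) =
      MvPolynomial.rename Sum.inl (delta d) +
        MvPolynomial.X (Sum.inr 0) * MvPolynomial.rename Sum.inl (pre (inv a k)) := by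
  have h : projK (MvPolynomial.rename Sum.inl d + MvPolynomial.rename Sum.inr k) = k := by
    have := projK_rename_inl (n := n) hd
    have h2 := projK_rename_inr (X := X) k
    rw [projK] at *
    rw [map_add, this, h2, zero_add]
  rw [closedForm, h, projD_add, projD_rename_inl hd, projD_rename_inr, add_zero]

/-- Without difference variables the closed form is `t` times a ring homomorphism, so its vanishing
on `V` extends to the ideal generated by `V`. -/
theorem closedForm_rename_inr (a : Fin n → MvPolynomial X ℚ) (k : MvPolynomial (Fin n) ℚ) :
    closedForm a (MvPolynomial.rename Sum.inr k) =
      MvPolynomial.X (Sum.inr 0) * MvPolynomial.rename Sum.inl (pre (inv a k)) := by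
  have := closedForm_rename_add a (zero_mem (linTerms X)) k
  simpa using this

theorem holds_expFormula {A : Type*} [CommRing A] [Algebra ℚ A] (S : IntRealRing A)
    (a : Fin n → MvPolynomial X ℚ) (V : Finset (MvPolynomial (Fin n) ℚ))
    (R : Finset (MvPolynomial (X ⊕ Fin n) ℚ)) (v : X ⊕ X → A) (xs : Fin 1 → A) :
    S.Holds (expFormula a V R) v xs ↔
      (∀ k ∈ V, MvPolynomial.aeval (Sum.elim v xs)
        (closedForm a (MvPolynomial.rename Sum.inr k)) = 0) ∧
      ∀ r ∈ R, MvPolynomial.aeval (Sum.elim v xs) (closedForm a r) ∈ S.pos := by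
  let _ := S.toStructure
  refine FirstOrder.Language.BoundedFormula.realize_inf.trans (and_congr ?_ ?_)
  · refine FirstOrder.Language.BoundedFormula.realize_iInf.trans ?_
    exact ⟨fun h k hk => (S.holds_fZero _ _ _).1 (h ⟨k, hk⟩),
      fun h k => (S.holds_fZero _ _ _).2 (h k k.2)⟩
  · refine FirstOrder.Language.BoundedFormula.realize_iInf.trans ?_
    exact ⟨fun h r hr => (S.holds_fNonneg _ _ _).1 (h ⟨r, hr⟩),
      fun h r => (S.holds_fNonneg _ _ _).2 (h r r.2)⟩

/-- The closed forms of all polynomials in the cone are nonnegative where `exp` holds. -/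
theorem closedForm_mem_pos {A : Type*} [CommRing A] [Algebra ℚ A] {S : IntRealRing A}
    {a : Fin n → MvPolynomial X ℚ} {V : Finset (MvPolynomial (Fin n) ℚ)}
    {R : Finset (MvPolynomial (X ⊕ Fin n) ℚ)} {v : X ⊕ X → A} {xs : Fin 1 → A}
    (h : S.Holds (expFormula a V R) v xs) {p : MvPolynomial (X ⊕ Fin n) ℚ}
    (hp : p ∈ linCone V R) :
    MvPolynomial.aeval (Sum.elim v xs) (closedForm a p) ∈ S.pos := by
  obtain ⟨hV, hR⟩ := (holds_expFormula S a V R v xs).1 h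
  obtain ⟨_, ⟨k, hk, rfl⟩, r, hr, rfl⟩ := hp
  have h1 : MvPolynomial.aeval (Sum.elim v xs)
      (closedForm a (MvPolynomial.rename Sum.inr k)) = 0 := by
    induction hk using Submodule.span_induction with
    | mem k h => exact hV k h
    | zero =>
      rw [closedForm_rename_inr]
      simp [pre]
    | add k l _ _ hk hl => rw [map_add, closedForm_add, map_add, hk, hl, add_zero]
    | smul q k _ hk =>
      rw [closedForm_rename_inr, map_mul] at hk
      rw [closedForm_rename_inr, smul_eq_mul, pre, map_mul, map_mul, map_mul, map_mul, map_mul,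
        mul_left_comm]
      rw [pre] at hk
      rw [hk, mul_zero]
  have h2 : MvPolynomial.aeval (Sum.elim v xs) (closedForm a r) ∈ S.pos := by
    induction hr using Submodule.span_induction with
    | mem r h => exact hR r h
    | zero => simp [closedForm, projD, projK, pre]
    | add r s _ _ hr hs =>
      rw [closedForm_add, map_add]
      exact add_mem hr hs
    | smul q r _ hr =>
      change MvPolynomial.aeval (Sum.elim v xs) (closedForm a ((q : ℚ) • r)) ∈ S.pos
      rw [closedForm_smul, map_smul]
      exact PointedCone.smul_mem _ q.2 hr
  rw [closedForm_add, map_add, h1, zero_add]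
  exact h2

/-- The approximation of the reflexive transitive closure is monotone. -/
theorem IsStar.mono {F G SF SG : sig.Formula (X ⊕ X)} (hFG : Entails F G) (hF : IsStar F SF)
    (hG : IsStar G SG) : Entails SF SG := by
  obtain ⟨_, ⟨n, a, Z, P, Z', P', V, R, -, ha, hZP, hZP', hVR, rfl⟩, rfl⟩ := hF
  obtain ⟨_, ⟨m, b, Y, Q, Y', Q', W, T, -, hb, hYQ, hYQ', hWT, rfl⟩, rfl⟩ := hG
  -- Entailment makes each invariant of `G` an invariant of `F`, and the family `a` spans those.
  have hbF : ∀ j, ∃ c : Fin n → ℚ, ∑ i, c i • a i = b j := by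
    intro j
    have h1 : b j ∈ linInv G := hb ▸ Submodule.subset_span (Set.mem_range_self j)
    have h2 : b j ∈ linInv F := ⟨h1.1, FirstOrder.Language.Theory.Imp.trans hFG h1.2⟩
    rw [← ha] at h2
    exact (Submodule.mem_span_range_iff_exists_fun ℚ).1 h2
  choose c hc using hbF
  -- The substitution that expresses the invariant variables of `G` through those of `F`; `η`
  -- extends it by fixing the difference variables.
  let κ : Fin m → MvPolynomial (Fin n) ℚ := fun j => ∑ i, c j i • MvPolynomial.X i
  let ηK : MvPolynomial (Fin m) ℚ →ₐ[ℚ] MvPolynomial (Fin n) ℚ := MvPolynomial.aeval κ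
  let η : MvPolynomial (X ⊕ Fin m) ℚ →ₐ[ℚ] MvPolynomial (X ⊕ Fin n) ℚ :=
    MvPolynomial.aeval (Sum.elim (fun x => MvPolynomial.X (Sum.inl x))
      (fun j => MvPolynomial.rename Sum.inr (κ j)))
  have hηl : ∀ d : MvPolynomial X ℚ,
      η (MvPolynomial.rename Sum.inl d) = MvPolynomial.rename Sum.inl d := by
    intro d
    simp only [η]
    rw [MvPolynomial.aeval_rename, Sum.elim_comp_inl, MvPolynomial.rename_eq_aeval]
    rfl
  have hηr : ∀ k : MvPolynomial (Fin m) ℚ,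
      η (MvPolynomial.rename Sum.inr k) = MvPolynomial.rename Sum.inr (ηK k) := by
    intro k
    have : (η.comp (MvPolynomial.rename Sum.inr)) = (MvPolynomial.rename Sum.inr).comp ηK := by
      ext j : 1
      simp [η, ηK]
    exact DFunLike.congr_fun this k
  have hinv : ∀ k, inv a (ηK k) = inv b k := by
    intro k
    have : (inv a).comp ηK = inv b := by
      ext j : 1
      simp [ηK, κ, inv, hc]
    exact DFunLike.congr_fun this k
  have hdelta : ∀ p, deltaInv a (η p) = deltaInv b p := by
    intro p
    have : (deltaInv a).comp η = deltaInv b := by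
      ext j : 1
      rcases j with x | j
      · simp [η, deltaInv]
      · have h1 : deltaInv a (MvPolynomial.rename Sum.inr (κ j)) = pre (inv a (κ j)) := by
          rw [deltaInv, MvPolynomial.aeval_rename, Sum.elim_comp_inr, inv, pre]
          have : MvPolynomial.aeval (fun i => pre (a i)) =
              (MvPolynomial.rename Sum.inl).comp (MvPolynomial.aeval a) := by
            ext i : 1
            simp [pre]
          exact DFunLike.congr_fun this (κ j)
        have h2 : inv a (κ j) = b j := by simp [κ, inv, hc]
        rw [AlgHom.comp_apply]
        simp only [η, MvPolynomial.aeval_X, Sum.elim_inr]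
        rw [h1, h2]
        simp [deltaInv]
    exact DFunLike.congr_fun this p
  -- Restricted to `linPlusPoly`, where the two projections of a polynomial determine it and `η`
  -- acts on each summand separately.
  have hclosed : ∀ p ∈ linPlusPoly X m, closedForm a (η p) = closedForm b p := by
    rintro _ ⟨d, hd, k, rfl⟩
    rw [map_add, hηl, hηr, closedForm_rename_add _ hd, closedForm_rename_add _ hd, hinv]
  have hcone : ∀ p ∈ linCone W T, η p ∈ linCone V R := by
    intro p hp
    rw [hWT] at hp
    obtain ⟨h1, d, hd, k, rfl⟩ := hp
    rw [hVR]
    constructor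
    · rw [hYQ', Set.mem_preimage, hYQ] at h1
      rw [hZP', Set.mem_preimage, hZP, hdelta]
      exact consequenceCone_anti hFG h1
    · exact ⟨d, hd, ηK k, by rw [map_add, hηl, hηr]⟩
  refine (entails_iff _ _).2 fun A _ _ _ S v xs h => ?_
  let _ := S.toStructure
  obtain ⟨t, ht⟩ := FirstOrder.Language.BoundedFormula.realize_ex.1 h
  refine FirstOrder.Language.BoundedFormula.realize_ex.2 ⟨t, ?_⟩
  rw [FirstOrder.Language.BoundedFormula.realize_inf,
    FirstOrder.Language.BoundedFormula.realize_inf] at ht ⊢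
  refine ⟨ht.1, ht.2.1, ?_⟩
  have hpos : ∀ p ∈ linCone W T,
      MvPolynomial.aeval (Sum.elim v (Fin.snoc xs t)) (closedForm b p) ∈ S.pos := by
    intro p hp
    rw [← hclosed p (by rw [hWT] at hp; exact hp.2)]
    exact closedForm_mem_pos ht.2.2 (hcone p hp)
  have hmemW : ∀ k ∈ Ideal.span (W : Set (MvPolynomial (Fin m) ℚ)),
      MvPolynomial.rename Sum.inr k ∈ linCone W T := fun k hk =>
    ⟨_, ⟨k, hk, rfl⟩, 0, zero_mem (PointedCone.hull ℚ _), add_zero _⟩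
  refine (holds_expFormula S b W T v _).2 ⟨fun k hk => ?_, fun r hr => ?_⟩
  · have hk' := Ideal.subset_span (α := MvPolynomial (Fin m) ℚ) hk
    -- An equation of `G` need not come from an equation of `F`: both `k` and `-k` lie in the cone,
    -- and antisymmetry of the order yields zero.
    refine S.eq_zero _ (hpos _ (hmemW k hk')) ?_
    have := hpos _ (hmemW (-k) (neg_mem hk'))
    rwa [map_neg, ← neg_one_smul ℚ, closedForm_smul, neg_one_smul, map_neg] at this
  · exact hpos r ⟨0, ⟨0, zero_mem _, map_zero _⟩, r, PointedCone.subset_hull hr, zero_add _⟩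

end Monotonicity

end LIRing

theorem mainTheorem10 {X : Type*} [Fintype X] :
    (∀ F : LIRing.sig.Formula (X ⊕ X), LIRing.IsTransitionFormula F →
      ∃ S : LIRing.sig.Formula (X ⊕ X), LIRing.IsStar F S) ∧
    ∀ F G : LIRing.sig.Formula (X ⊕ X),
      LIRing.Entails F G →
      ∀ SF SG : LIRing.sig.Formula (X ⊕ X), LIRing.IsStar F SF → LIRing.IsStar G SG →
        LIRing.Entails SF SG :=
  ⟨fun _ hF => hF.exists_isStar, fun _ _ hFG _ _ hF hG => hF.mono hFG hG⟩
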